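/- Let $m,n\ge 1$, $d=m+n$, $G=\mathrm{SL}_d(\mathbb{R})$, $X_d=\mathrm{SL}_d(\mathbb{R})/\mathrm{SL}_d(\mathbb{Z})$, and for $t\in\mathbb{R}$ let $$a_t=\mathrm{diag}(\underbrace{e^{t/m},\dots,e^{t/m}}_{m},\underbrace{e^{-t/n},\dots,e^{-t/n}}_{n})\in G.$$ Let $\mathfrak{p}$ be the Lie algebra of traceless $d\times d$ matrices whose upper right $m\times n$ block is zero (the Lie algebra of $P=\{g\in G:\lim_{t\to\infty}a_tga_{-t}\text{ exists}\}$), and let $\mathfrak{g}^+$ be the Lie algebra of $d\times d$ matrices all of whose entries outside the upper right $m\times n$ block are zero (the Lie algebra of the expanding horospherical subgroup $G^+=\{g\in G: a_tga_{-t}\to 1\text{ as }t\to-\infty\}$). Let $\varphi:[0,1]\to G$ be a real analytic curve and let $\Lambda\in X_d$. For every $s\in[0,1]$ there is a unique $Y_s\in\mathfrak{g}^+$ (the tangent direction at $s$ of the curve in the horosphere) such that, for all sufficiently small $\xi$ with $s+\xi\in[0,1]$, one can write $$\varphi(s+\xi)\varphi(s)^{-1}=\exp(\Phi^{0-}(s,\xi))\exp(\Phi^{+}(s,\xi)),\qquad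 \Phi^{0-}(s,\xi)\in\mathfrak{p},\quad \Phi^+(s,\xi)\in\mathfrak{g}^+,$$ with $\Phi^{0-}(s,\xi)=O(\xi)$ and $\Phi^+(s,\xi)=\xi Y_s+O(\xi^2)$ as $\xi\to0$. For $s\in[0,1]$ and $T>0$ let $\mu_{s,T}$ be the push-forward of the uniform probability measure on $[0,T]$ under $t\mapsto a_t\varphi(s)\Lambda$. Then for Lebesgue-almost every $s\in[0,1]$ the following holds: whenever $\mu$ is a locally finite Borel measure on $X_d$ and $T_k\to\infty$ is a sequence with $\int f\,d\mu_{s,T_k}\to\int f\,d\mu$ for every $f\in C_c(X_d)$ (that is, $\mu$ is a weak* limit of $\mu_{s,T}$ as $T\to\infty$), the measure $\mu$ is invariant under $y\mapsto\exp(xY_s)\,y$ for every $x\in\mathbb{R}$. -/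

import Mathlib

open MeasureTheory Filter Topology Set
open scoped CompactlySupported

namespace HorosphereCurve

noncomputable section

/-- `G = SL_d(ℝ)` with `d = m + n`; rows and columns are indexed by `Fin m ⊕ Fin n`, so that the
block decomposition of type `(m, n)` is visible. -/
abbrev G (m n : ℕ) : Type := Matrix.SpecialLinearGroup (Fin m ⊕ Fin n) ℝ

/-- `Γ = SL_d(ℤ)`, as a subgroup of `SL_d(ℝ)`. -/
abbrev Gam (m n : ℕ) : Subgroup (G m n) :=
  (Matrix.SpecialLinearGroup.map (n := Fin m ⊕ Fin n) (Int.castRingHom ℝ)).range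

/-- The space `X_d = SL_d(ℝ) / SL_d(ℤ)`, with the quotient topology and the left action of `G`. -/
abbrev X (m n : ℕ) : Type := G m n ⧸ Gam m n

/-- The Borel sigma-algebra on `X_d`. -/
instance instMeasurableSpaceX (m n : ℕ) : MeasurableSpace (X m n) := borel (X m n)

instance instBorelSpaceX (m n : ℕ) : BorelSpace (X m n) := ⟨rfl⟩

/-- The diagonal flow `a_t = diag(e^{t/m}, …, e^{t/m}, e^{-t/n}, …, e^{-t/n})`. -/
def a (m n : ℕ) [NeZero m] [NeZero n] (t : ℝ) : G m n :=
  ⟨Matrix.diagonal (Sum.elim (fun _ : Fin m => Real.exp (t / m))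
      (fun _ : Fin n => Real.exp (-t / n))), by
    have hm : (m : ℝ) ≠ 0 := Nat.cast_ne_zero.2 (NeZero.ne m)
    have hn : (n : ℝ) ≠ 0 := Nat.cast_ne_zero.2 (NeZero.ne n)
    rw [Matrix.det_diagonal, Fintype.prod_sum_type]
    simp only [Sum.elim_inl, Sum.elim_inr, Finset.prod_const, Finset.card_univ, Fintype.card_fin]
    rw [← Real.exp_nat_mul, ← Real.exp_nat_mul, ← Real.exp_add, mul_div_cancel₀ _ hm,
      mul_div_cancel₀ _ hn, add_neg_cancel, Real.exp_zero]⟩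

/-- The element of `𝔤⁺ = Lie(G⁺)` with upper right `m × n` block `Y`. This identifies `Mat_{mn}(ℝ)`
with the Lie algebra of the expanding horospherical subgroup
`G⁺ = {g : a_t g a_{-t} → 1 as t → -∞}`. -/
def gPlus {m n : ℕ} (Y : Matrix (Fin m) (Fin n) ℝ) : Matrix (Fin m ⊕ Fin n) (Fin m ⊕ Fin n) ℝ :=
  Matrix.fromBlocks 0 Y 0 0

/-- The Lie algebra `𝔭` of the parabolic subgroup `P = {g : lim_{t → ∞} a_t g a_{-t} exists}`: the
traceless matrices whose upper right `m × n` block vanishes. -/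
def parabolicLie (m n : ℕ) : Set (Matrix (Fin m ⊕ Fin n) (Fin m ⊕ Fin n) ℝ) :=
  {M | M.trace = 0 ∧ M.toBlocks₁₂ = 0}

theorem exp_smul_gPlus {m n : ℕ} (Y : Matrix (Fin m) (Fin n) ℝ) (x : ℝ) :
    NormedSpace.exp (x • gPlus Y) = Matrix.fromBlocks 1 (x • Y) 0 1 := by
  have h : (x • gPlus Y) ^ 2 = 0 := by
    simp [gPlus, pow_two, Matrix.fromBlocks_smul, Matrix.fromBlocks_multiply]
  have h' : NormedSpace.exp (x • gPlus Y) = 1 + x • gPlus Y := by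
    rw [NormedSpace.exp_eq_tsum ℝ]
    beta_reduce
    rw [tsum_eq_sum (s := Finset.range 2)]
    · simp [Finset.sum_range_succ]
    · intro k hk
      have hk' : 2 ≤ k := Nat.le_of_not_lt fun h2 => hk (Finset.mem_range.2 h2)
      rw [pow_eq_zero_of_le hk' h, smul_zero]
  rw [h', gPlus, Matrix.fromBlocks_smul, ← Matrix.fromBlocks_one, Matrix.fromBlocks_add]
  simp

/-- The unipotent one-parameter flow `x ↦ exp(x Y)` in `SL_d(ℝ)`, for `Y ∈ 𝔤⁺`. -/
def unipotentFlow {m n : ℕ} (Y : Matrix (Fin m) (Fin n) ℝ) (x : ℝ) : G m n :=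
  ⟨NormedSpace.exp (x • gPlus Y), by
    rw [exp_smul_gPlus, Matrix.det_fromBlocks_zero₂₁, Matrix.det_one, Matrix.det_one, mul_one]⟩

/-- The curve `φ : [0,1] → G` is (real) analytic; only the values on `[0,1]` matter. -/
def IsAnalyticCurve {m n : ℕ} (φ : ℝ → G m n) : Prop :=
  ∀ i j, AnalyticOn ℝ (fun s => (φ s : Matrix (Fin m ⊕ Fin n) (Fin m ⊕ Fin n) ℝ) i j) (Icc 0 1)

/-- `Y = Y_s` is the tangent direction at `s` of the curve `φ` in the horosphere: for all small `ξ`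
with `s + ξ ∈ [0,1]`,
`φ(s + ξ) φ(s)⁻¹ = exp(Φ⁰⁻(ξ)) exp(Φ⁺(ξ))` with `Φ⁰⁻(ξ) ∈ 𝔭` and `Φ⁺(ξ) ∈ 𝔤⁺`, where
`Φ⁰⁻(ξ) = O(ξ)` and `Φ⁺(ξ) = ξ Y + O(ξ²)` as `ξ → 0` (entrywise). -/
def IsHorosphericalTangent {m n : ℕ} (φ : ℝ → G m n) (s : ℝ) (Y : Matrix (Fin m) (Fin n) ℝ) :
    Prop :=
  ∃ (Φm : ℝ → Matrix (Fin m ⊕ Fin n) (Fin m ⊕ Fin n) ℝ) (Φp : ℝ → Matrix (Fin m) (Fin n) ℝ),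
    (∀ᶠ ξ in 𝓝[{ξ : ℝ | s + ξ ∈ Icc (0 : ℝ) 1}] 0,
      Φm ξ ∈ parabolicLie m n ∧
      ((φ (s + ξ) * (φ s)⁻¹ : G m n) : Matrix (Fin m ⊕ Fin n) (Fin m ⊕ Fin n) ℝ) =
        NormedSpace.exp (Φm ξ) * NormedSpace.exp (gPlus (Φp ξ))) ∧
    (∀ i j, (fun ξ => Φm ξ i j) =O[𝓝[{ξ : ℝ | s + ξ ∈ Icc (0 : ℝ) 1}] 0] (fun ξ => ξ)) ∧
    (∀ i j, (fun ξ => Φp ξ i j - ξ * Y i j)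
      =O[𝓝[{ξ : ℝ | s + ξ ∈ Icc (0 : ℝ) 1}] 0] (fun ξ => ξ ^ 2))

/-- The time average `μ_{s,T}`: the push-forward of the uniform probability measure on `[0,T]`
under `t ↦ a_t φ(s) Λ` (for `T > 0`). -/
def timeAverage {m n : ℕ} [NeZero m] [NeZero n] (φ : ℝ → G m n) (Λ : X m n) (s T : ℝ) :
    Measure (X m n) :=
  (ENNReal.ofReal T)⁻¹ •
    Measure.map (fun t : ℝ => a m n t • φ s • Λ) (volume.restrict (Icc 0 T))

/-- `μ` is a weak* limit, as `T → ∞`, of the family of measures `ν T`: along some sequence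
`T_k → ∞`, `∫ f dν_{T_k} → ∫ f dμ` for all continuous compactly supported `f`. -/
def IsWeakStarLimit {m n : ℕ} (ν : ℝ → Measure (X m n)) (μ : Measure (X m n)) : Prop :=
  ∃ T : ℕ → ℝ, Tendsto T atTop atTop ∧
    ∀ f : C_c(X m n, ℝ), Tendsto (fun k => ∫ y, f y ∂(ν (T k))) atTop (𝓝 (∫ y, f y ∂μ))

end

end HorosphereCurve

/-! Put λ = 1/m + 1/n (`rate`). Conjugation by a_t multiplies the upper right block by e^{λt}, fixes
the diagonal blocks and contracts the lower left one. Hence the conjugate of φ(s + x e^{-λt}) φ(s)⁻¹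
tends to exp(x Y_s) (`tendsto_conj_increment`), and a_t φ(s + x e^{-λt}) Λ shadows exp(x Y_s) a_t
φ(s) Λ. Invariance of the weak* limits therefore reduces to showing that the time averages of D_t(s)
= f(a_t φ(s) Λ) - f(a_t φ(s + x e^{-λt}) Λ) tend to 0 for almost every s.

No mixing of the flow is needed for this. If f is Lipschitz along G, then s ↦ f(a_t φ(s) Λ) is
Lipschitz with constant O(e^{λt}). For r ≤ t the function D_r thus changes only by O(e^{-λ(t-r)})
under a shift by x e^{-λt}, and moving the shift in D_t onto D_r by a change of variables gives ∫
D_t D_r ds = O(e^{-λ(t-r)}) (`ae_tendsto_average_increment`). A second moment bound, summed along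
the times k², turns this decay of correlations into almost sure convergence
(`ae_tendsto_average_zero`).

General test functions are uniform limits of Lipschitz ones (`exists_lipschitz_approx`). A countable
dense set of test functions and rational x give one null set of s valid for all f and x
(`ae_tendsto_average_unipotent`).

The tangent Y_s (`existsUnique_isHorosphericalTangent`) comes from factoring φ(s + ξ) φ(s)⁻¹ into a
block lower triangular and a block unipotent matrix. It is unique because it is the derivative of
the upper right block. -/

namespace HorosphereCurve

/-! ### A submultiplicative norm on matrices and a length function on SL_d(ℝ). -/

section EntrySum

variable {ι : Type*} [Fintype ι]

/-- The sum of the absolute values of the entries, a submultiplicative norm on matrices. -/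
def entrySum (M : Matrix ι ι ℝ) : ℝ := ∑ i, ∑ j, |M i j|

theorem entrySum_nonneg (M : Matrix ι ι ℝ) : 0 ≤ entrySum M :=
  Finset.sum_nonneg fun _ _ => Finset.sum_nonneg fun _ _ => abs_nonneg _

theorem abs_apply_le_entrySum (M : Matrix ι ι ℝ) (i j : ι) : |M i j| ≤ entrySum M :=
  (Finset.single_le_sum (f := fun j => |M i j|) (fun _ _ => abs_nonneg _)
    (Finset.mem_univ j)).trans
    (Finset.single_le_sum (f := fun i => ∑ j, |M i j|)
      (fun _ _ => Finset.sum_nonneg fun _ _ => abs_nonneg _) (Finset.mem_univ i))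

theorem entrySum_add_le (A B : Matrix ι ι ℝ) : entrySum (A + B) ≤ entrySum A + entrySum B := by
  simp only [entrySum, ← Finset.sum_add_distrib]
  exact Finset.sum_le_sum fun i _ => Finset.sum_le_sum fun j _ => abs_add_le _ _

theorem entrySum_mul_le (A B : Matrix ι ι ℝ) : entrySum (A * B) ≤ entrySum A * entrySum B := by
  have h1 : entrySum (A * B) ≤ ∑ i, ∑ j, ∑ k, |A i k| * |B k j| := by
    refine Finset.sum_le_sum fun i _ => Finset.sum_le_sum fun j _ => ?_
    rw [Matrix.mul_apply]
    exact (Finset.abs_sum_le_sum_abs _ _).trans (by simp only [abs_mul, le_refl])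
  refine h1.trans ?_
  rw [entrySum, Finset.sum_mul]
  refine Finset.sum_le_sum fun i _ => ?_
  rw [Finset.sum_comm, Finset.sum_mul]
  refine Finset.sum_le_sum fun k _ => ?_
  rw [← Finset.mul_sum]
  refine mul_le_mul_of_nonneg_left ?_ (abs_nonneg _)
  exact Finset.single_le_sum (f := fun k => ∑ j, |B k j|)
    (fun _ _ => Finset.sum_nonneg fun _ _ => abs_nonneg _) (Finset.mem_univ k)

theorem continuous_entrySum : Continuous (entrySum : Matrix ι ι ℝ → ℝ) := by
  unfold entrySum
  fun_prop

end EntrySum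

section Length

variable {ι : Type*} [Fintype ι] [DecidableEq ι]

local notation "SL" => Matrix.SpecialLinearGroup ι ℝ

/-- The distance to the identity of `g` and `g⁻¹`, measured by `entrySum`. -/
def dev (g : SL) : ℝ :=
  max (entrySum ((g : Matrix ι ι ℝ) - 1)) (entrySum (((g⁻¹ : SL) : Matrix ι ι ℝ) - 1))

/-- A length function on `SL_d(ℝ)`. -/
noncomputable def len (g : SL) : ℝ := Real.log (1 + dev g)

theorem dev_nonneg (g : SL) : 0 ≤ dev g := (entrySum_nonneg _).trans (le_max_left _ _)

theorem dev_inv (g : SL) : dev g⁻¹ = dev g := by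
  rw [dev, dev, inv_inv, max_comm]

theorem len_inv (g : SL) : len g⁻¹ = len g := by rw [len, len, dev_inv]

theorem len_nonneg (g : SL) : 0 ≤ len g :=
  Real.log_nonneg (by linarith [dev_nonneg g])

theorem len_le_dev (g : SL) : len g ≤ dev g := by
  have := Real.log_le_sub_one_of_pos (x := 1 + dev g) (by linarith [dev_nonneg g])
  rw [len]; linarith

theorem dev_one : dev (1 : SL) = 0 := by simp [dev, entrySum]

theorem len_one : len (1 : SL) = 0 := by simp [len, dev_one]

/-- The identity AB - 1 = (A - 1)(B - 1) + (A - 1) + (B - 1) is what makes `len`, defined with log(1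
+ ·), subadditive. -/
theorem one_add_entrySum_mul_le (A B : Matrix ι ι ℝ) :
    1 + entrySum (A * B - 1) ≤ (1 + entrySum (A - 1)) * (1 + entrySum (B - 1)) := by
  have h : A * B - 1 = (A - 1) * (B - 1) + ((A - 1) + (B - 1)) := by noncomm_ring
  rw [h]
  have h1 := entrySum_add_le ((A - 1) * (B - 1)) ((A - 1) + (B - 1))
  have h2 := entrySum_add_le (A - 1) (B - 1)
  have h3 := entrySum_mul_le (A - 1) (B - 1)
  nlinarith

theorem one_add_dev_mul_le (g h : SL) : 1 + dev (g * h) ≤ (1 + dev g) * (1 + dev h) := by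
  have hg := dev_nonneg g
  have hh := dev_nonneg h
  rw [dev, ← max_add_add_left]
  refine max_le ?_ ?_
  · rw [Matrix.SpecialLinearGroup.coe_mul]
    refine (one_add_entrySum_mul_le _ _).trans ?_
    gcongr
    · exact add_nonneg zero_le_one (entrySum_nonneg _)
    · exact le_max_left _ _
    · exact le_max_left _ _
  · rw [mul_inv_rev, Matrix.SpecialLinearGroup.coe_mul, mul_comm (1 + dev g)]
    refine (one_add_entrySum_mul_le _ _).trans ?_
    gcongr
    · exact add_nonneg zero_le_one (entrySum_nonneg _)
    · exact le_max_right _ _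
    · exact le_max_right _ _

theorem len_mul_le (g h : SL) : len (g * h) ≤ len g + len h := by
  have hg := dev_nonneg g
  have hh := dev_nonneg h
  have hgh := dev_nonneg (g * h)
  rw [len, len, len, ← Real.log_mul (by linarith) (by linarith)]
  exact Real.log_le_log (by linarith) (one_add_dev_mul_le g h)

theorem continuous_dev : Continuous (dev : SL → ℝ) := by
  have h : Continuous fun g : SL => (g : Matrix ι ι ℝ) := continuous_subtype_val
  exact (continuous_entrySum.comp (h.sub continuous_const)).max
    (continuous_entrySum.comp ((h.comp continuous_inv).sub continuous_const))

theorem tendsto_nhds_one_of_dev {α : Type*} {l : Filter α} {u : α → SL}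
    (h : Tendsto (fun x => entrySum ((u x : Matrix ι ι ℝ) - 1)) l (𝓝 0)) :
    Tendsto u l (𝓝 1) := by
  refine tendsto_subtype_rng.2 ?_
  refine tendsto_pi_nhds.2 fun i => tendsto_pi_nhds.2 fun j => ?_
  rw [tendsto_iff_dist_tendsto_zero]
  refine squeeze_zero (fun _ => dist_nonneg) (fun x => ?_) h
  exact abs_apply_le_entrySum ((u x : Matrix ι ι ℝ) - 1) i j

/-- Entries of g - 1 are bounded by e^{len g} - 1, so small length forces g close to the identity.
-/
theorem exists_len_lt_subset {U : Set SL} (hU : U ∈ 𝓝 (1 : SL)) :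
    ∃ δ > 0, ∀ g : SL, len g < δ → g ∈ U := by
  have h : Tendsto (id : SL → SL) (comap len (𝓝 0)) (𝓝 1) := by
    apply tendsto_nhds_one_of_dev
    have h1 : Tendsto (fun g : SL => Real.exp (len g) - 1) (comap len (𝓝 0)) (𝓝 0) := by
      have := ((Real.continuous_exp.sub continuous_const).tendsto' 0 (1 - 1) (by simp) :
        Tendsto (fun x => Real.exp x - 1) (𝓝 0) (𝓝 (1 - 1)))
      rw [sub_self] at this
      exact this.comp tendsto_comap
    refine squeeze_zero (fun _ => entrySum_nonneg _) (fun g => ?_) h1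
    rw [len, Real.exp_log (by linarith [dev_nonneg g]), add_sub_cancel_left]
    exact le_max_left _ _
  obtain ⟨V, hV, hVU⟩ := mem_comap.1 (h hU)
  obtain ⟨δ, hδ, hball⟩ := Metric.mem_nhds_iff.1 hV
  refine ⟨δ, hδ, fun g hg => hVU (hball ?_)⟩
  simpa [abs_of_nonneg (len_nonneg g)] using hg

instance instLocallyCompactSpaceSL : LocallyCompactSpace SL := by
  have : IsClosed {A : Matrix ι ι ℝ | A.det = 1} :=
    isClosed_eq (Continuous.matrix_det continuous_id) continuous_const
  have : LocallyCompactSpace (Matrix ι ι ℝ) :=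
    inferInstanceAs (LocallyCompactSpace (ι → ι → ℝ))
  exact IsClosed.locallyCompactSpace ‹_›

instance instSecondCountableTopologySL : SecondCountableTopology SL := by
  have : SecondCountableTopology (Matrix ι ι ℝ) :=
    inferInstanceAs (SecondCountableTopology (ι → ι → ℝ))
  exact TopologicalSpace.Subtype.secondCountableTopology {A : Matrix ι ι ℝ | A.det = 1}

end Length

/-! ### Compactly supported test functions. -/

/-- Compactly supported continuous functions are uniformly continuous along the action. -/
theorem eventually_forall_abs_smul_sub_lt {H Z : Type*} [Group H] [TopologicalSpace H]
    [IsTopologicalGroup H] [LocallyCompactSpace H] [TopologicalSpace Z] [MulAction H Z]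
    [ContinuousSMul H Z] (f : C_c(Z, ℝ)) {ε : ℝ} (hε : 0 < ε) :
    ∀ᶠ g : H in 𝓝 1, ∀ y, |f (g • y) - f y| < ε := by
  obtain ⟨V, hVc, hV⟩ := exists_compact_mem_nhds (1 : H)
  -- Off K = V⁻¹ · supp f, both f(y) and f(g y) vanish for g in V, so only the compact set K
  -- matters.
  set K := (fun p : H × Z => p.1⁻¹ • p.2) '' (V ×ˢ tsupport f) with hK
  have hKc : IsCompact K :=
    (hVc.prod f.hasCompactSupport.isCompact).image (by fun_prop)
  have h1 : ∀ᶠ g : H in 𝓝 1, ∀ y ∈ K, |f (g • y) - f y| < ε := by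
    apply hKc.eventually_forall_of_forall_eventually
    intro y _
    have hc : Continuous fun p : H × Z => |f (p.1 • p.2) - f p.2| := by
      have := f.continuous
      fun_prop
    exact hc.continuousAt.eventually_lt continuousAt_const (by simpa using hε)
  filter_upwards [h1, hV] with g hg hgV y
  by_cases hy : y ∈ K
  · exact hg y hy
  · have e1 : f y = 0 := by
      by_contra h
      exact hy ⟨(1, y), ⟨mem_of_mem_nhds hV, subset_tsupport _ h⟩, by simp⟩
    have e2 : f (g • y) = 0 := by
      by_contra h
      exact hy ⟨(g, g • y), ⟨hgV, subset_tsupport _ h⟩, by simp⟩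
    simpa [e1, e2] using hε

/-- `C_c(Z, ℝ)` has a countable subset which is dense for the uniform distance. -/
theorem exists_countable_dense_compactlySupported (Z : Type*) [TopologicalSpace Z]
    [T2Space Z] [LocallyCompactSpace Z] [SecondCountableTopology Z] :
    ∃ S : Set C_c(Z, ℝ), S.Countable ∧
      ∀ f : C_c(Z, ℝ), ∀ ε > 0, ∃ g ∈ S, ∀ y, |f y - g y| < ε := by
  let K : CompactExhaustion Z := CompactExhaustion.choice Z
  let C : ℕ → Set C_c(Z, ℝ) := fun k => {f | tsupport f ⊆ K k}
  have hD : ∀ k, ∃ D : Set C_c(Z, ℝ), D.Countable ∧ D ⊆ C k ∧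
      ∀ f ∈ C k, ∀ ε > 0, ∃ g ∈ D, ∀ y, |f y - g y| < ε := by
    intro k
    let ψ : C k → C(Z, ℝ) := fun f => f.1.toContinuousMap
    -- Density is taken inside the range of ψ, so that the approximants are also supported in K k.
    -- Closeness on K k in the compact-open topology is then uniform closeness on Z.
    obtain ⟨A, hAc, hAd⟩ := TopologicalSpace.exists_countable_dense (range ψ)
    choose pre hpre using fun h : range ψ => h.2
    refine ⟨(fun h => (pre h).1) '' A, hAc.image _, ?_, ?_⟩
    · rintro _ ⟨h, _, rfl⟩
      exact (pre h).2
    intro f hf ε hε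
    have ho : IsOpen {h : range ψ | MapsTo (fun y => ((f : Z → ℝ) y - h.1 y)) (K k)
        (Metric.ball 0 ε)} := by
      have h0 : IsOpen {h : C(Z, ℝ) | MapsTo h (K k) (Metric.ball 0 ε)} :=
        ContinuousMap.isOpen_setOfPred_mapsTo (K.isCompact k) Metric.isOpen_ball
      have hc : Continuous fun h : range ψ => f.toContinuousMap - h.1 := by fun_prop
      exact h0.preimage hc
    obtain ⟨h, hh, hhA⟩ := hAd.inter_open_nonempty _ ho
      ⟨⟨ψ ⟨f, hf⟩, mem_range_self _⟩, fun y _ => by simpa [ψ] using hε⟩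
    refine ⟨_, mem_image_of_mem _ hhA, fun y => ?_⟩
    have e : ∀ y, (pre h).1 y = h.1 y := fun y => DFunLike.congr_fun (hpre h) y
    by_cases hy : y ∈ K k
    · have := hh hy
      rw [e]
      simpa using this
    · have e1 : f y = 0 := image_eq_zero_of_notMem_tsupport fun h' => hy (hf h')
      have e2 : (pre h).1 y = 0 :=
        image_eq_zero_of_notMem_tsupport fun h' => hy ((pre h).2 h')
      simpa [e1, e2] using hε
  choose D hDc _ hDd using hD
  refine ⟨⋃ k, D k, countable_iUnion hDc, fun f ε hε => ?_⟩
  obtain ⟨k, hk⟩ := K.exists_superset_of_isCompact f.hasCompactSupport.isCompact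
  obtain ⟨g, hg, h⟩ := hDd k f hk ε hε
  exact ⟨g, mem_iUnion_of_mem k hg, h⟩

/-! ### Time averages under exponential decay of correlations. -/

theorem integrable_exp_neg_mul_abs {lam : ℝ} (hlam : 0 < lam) :
    Integrable fun r : ℝ => Real.exp (-lam * |r|) := by
  rw [← integrableOn_univ, ← Iic_union_Ioi (a := (0 : ℝ))]
  refine IntegrableOn.union ?_ ?_
  · refine (integrableOn_exp_mul_Iic hlam 0).congr_fun (fun r hr => ?_) measurableSet_Iic
    simp [abs_of_nonpos (mem_Iic.1 hr)]
  · refine (integrableOn_exp_mul_Ioi (neg_lt_zero.2 hlam) 0).congr_fun (fun r hr => ?_)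
      measurableSet_Ioi
    simp [abs_of_pos (mem_Ioi.1 hr)]

/-- Averages of a bounded function converge to zero if they do so along the squares. -/
theorem tendsto_average_of_squares {u : ℝ → ℝ} (hu : Measurable u) {C : ℝ} (hC : ∀ t, |u t| ≤ C)
    (h : Tendsto (fun k : ℕ => ((k : ℝ) ^ 2)⁻¹ * ∫ t in (0 : ℝ)..(k : ℝ) ^ 2, u t) atTop (𝓝 0)) :
    Tendsto (fun T : ℝ => T⁻¹ * ∫ t in (0 : ℝ)..T, u t) atTop (𝓝 0) := by
  have hC0 : 0 ≤ C := (abs_nonneg _).trans (hC 0)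
  have hint : ∀ p q : ℝ, IntervalIntegrable u volume p q := fun p q => by
    rw [intervalIntegrable_iff]
    exact Measure.integrableOn_of_bounded (M := C) measure_Ioc_lt_top.ne
      hu.aestronglyMeasurable (Eventually.of_forall fun t => hC t)
  have hk : Tendsto (fun T : ℝ => ⌊√T⌋₊) atTop atTop :=
    tendsto_nat_floor_atTop.comp Real.tendsto_sqrt_atTop
  have h1 := (h.comp hk).abs
  have h2 : Tendsto (fun T : ℝ => C * (3 * (√T)⁻¹)) atTop (𝓝 0) := by
    have := (Real.tendsto_sqrt_atTop.inv_tendsto_atTop.const_mul 3).const_mul C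
    simpa using this
  have h3 := h1.add h2
  rw [abs_zero, add_zero] at h3
  refine squeeze_zero_norm' ?_ h3
  filter_upwards [eventually_ge_atTop 1] with T hT
  have hs1 : 1 ≤ √T := Real.one_le_sqrt.2 hT
  have hsq : √T ^ 2 = T := Real.sq_sqrt (by linarith)
  set k := ⌊√T⌋₊ with hkdef
  have hk1 : (1 : ℝ) ≤ k := by exact_mod_cast (Nat.one_le_floor_iff _).2 hs1
  have hkle : (k : ℝ) ≤ √T := Nat.floor_le (by positivity)
  have hklt : √T < k + 1 := Nat.lt_floor_add_one _
  have hkT : (k : ℝ) ^ 2 ≤ T := by rw [← hsq]; gcongr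
  -- Here T - k² = (√T - k)(√T + k) with √T - k < 1, so the gap to the previous square is O(√T),
  -- negligible against T.
  have hTk : T - (k : ℝ) ^ 2 ≤ 3 * √T := by nlinarith
  have hT0 : 0 < T := by linarith
  have hsplit := intervalIntegral.integral_add_adjacent_intervals (hint 0 ((k : ℝ) ^ 2))
    (hint ((k : ℝ) ^ 2) T)
  have hrest : |∫ t in (k : ℝ) ^ 2..T, u t| ≤ C * (3 * √T) := by
    have := intervalIntegral.norm_integral_le_of_norm_le_const
      (a := (k : ℝ) ^ 2) (b := T) (f := u) (C := C) (fun t _ => hC t)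
    rw [Real.norm_eq_abs, abs_of_nonneg (sub_nonneg.2 hkT)] at this
    exact this.trans (mul_le_mul_of_nonneg_left hTk hC0)
  simp only [Function.comp_apply]
  rw [← hsplit, mul_add, Real.norm_eq_abs]
  refine (abs_add_le _ _).trans (add_le_add ?_ ?_)
  · have hk2 : (0 : ℝ) < (k : ℝ) ^ 2 := by positivity
    rw [abs_mul, abs_mul, abs_of_pos (inv_pos.2 hT0), ← hkdef, abs_of_pos (inv_pos.2 hk2)]
    gcongr
  · rw [abs_mul, abs_of_pos (inv_pos.2 hT0)]
    calc T⁻¹ * |∫ t in (k : ℝ) ^ 2..T, u t| ≤ T⁻¹ * (C * (3 * √T)) := by gcongr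
      _ = C * (3 * (√T)⁻¹) := by
        have : √T ≠ 0 := by positivity
        nth_rewrite 1 [← hsq]
        field_simp

variable {Ω : Type*} [MeasurableSpace Ω]

/-- Fubini writes the second moment as an integral of correlations over the square (0,T]². The
kernel e^{-lam|t-r|} has an integral in r bounded uniformly in t, so the growth is linear in T
instead of quadratic. -/
theorem integral_sq_integral_le {ν : Measure Ω} [IsFiniteMeasure ν] {D : ℝ → Ω → ℝ}
    (hD : Measurable (Function.uncurry D)) {C : ℝ} (hC : ∀ t s, |D t s| ≤ C) {B lam : ℝ}
    (hlam : 0 < lam)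
    (hB : ∀ r t, 0 ≤ r → r ≤ t → |∫ s, D t s * D r s ∂ν| ≤ B * Real.exp (-lam * (t - r)))
    {T : ℝ} (hT : 0 ≤ T) :
    ∫ s, (∫ t in (0 : ℝ)..T, D t s) ^ 2 ∂ν ≤ B * (∫ r, Real.exp (-lam * |r|)) * T := by
  have hB0 : 0 ≤ B := by simpa using (abs_nonneg _).trans (hB 0 0 le_rfl le_rfl)
  have hC0 : ∀ t s, ‖D t s‖ ≤ C := hC
  set κ : Measure ℝ := volume.restrict (Ioc 0 T) with hκ
  have e1 : ∀ s, (∫ t in (0 : ℝ)..T, D t s) ^ 2 =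
      ∫ p : ℝ × ℝ, D p.1 s * D p.2 s ∂(κ.prod κ) := fun s => by
    rw [intervalIntegral.integral_of_le hT, sq, integral_prod_mul (fun t => D t s) (fun t => D t s)]
  simp_rw [e1]
  have hm : Measurable fun q : Ω × (ℝ × ℝ) => D q.2.1 q.1 * D q.2.2 q.1 :=
    (hD.comp (measurable_snd.fst.prodMk measurable_fst)).mul
      (hD.comp (measurable_snd.snd.prodMk measurable_fst))
  rw [integral_integral_swap]
  swap
  · refine Integrable.of_bound hm.aestronglyMeasurable (C * C) (Eventually.of_forall fun q => ?_)
    simp only [Function.uncurry, norm_mul]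
    exact mul_le_mul (hC0 _ _) (hC0 _ _) (norm_nonneg _) ((norm_nonneg _).trans (hC0 q.2.1 q.1))
  have hE : Continuous fun p : ℝ × ℝ => B * Real.exp (-lam * |p.1 - p.2|) := by fun_prop
  have hEi : Integrable (fun p : ℝ × ℝ => B * Real.exp (-lam * |p.1 - p.2|)) (κ.prod κ) := by
    refine Integrable.of_bound hE.aestronglyMeasurable B (Eventually.of_forall fun p => ?_)
    rw [Real.norm_eq_abs, abs_of_nonneg (by positivity)]
    refine mul_le_of_le_one_right hB0 (Real.exp_le_one_iff.2 ?_)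
    have := mul_nonneg hlam.le (abs_nonneg (p.1 - p.2))
    linarith
  have hpos : ∀ᵐ t ∂κ, 0 ≤ t := by
    filter_upwards [ae_restrict_mem measurableSet_Ioc] with t ht using ht.1.le
  calc ∫ p : ℝ × ℝ, ∫ s, D p.1 s * D p.2 s ∂ν ∂(κ.prod κ)
      ≤ ∫ p : ℝ × ℝ, B * Real.exp (-lam * |p.1 - p.2|) ∂(κ.prod κ) := by
        refine integral_mono_ae ?_ hEi ?_
        · have := (hm.comp measurable_swap).stronglyMeasurable.integral_prod_right' (ν := ν)
          refine Integrable.of_bound this.aestronglyMeasurable (C * C * ν.real univ)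
            (Eventually.of_forall fun p => ?_)
          refine norm_integral_le_of_norm_le_const (Eventually.of_forall fun s => ?_)
          rw [norm_mul]
          exact mul_le_mul (hC0 _ _) (hC0 _ _) (norm_nonneg _) ((norm_nonneg _).trans (hC0 0 s))
        · filter_upwards [Measure.quasiMeasurePreserving_fst.ae hpos,
            Measure.quasiMeasurePreserving_snd.ae hpos] with p hp1 hp2
          rcases le_total p.2 p.1 with h | h
          · rw [abs_of_nonneg (sub_nonneg.2 h)]
            exact (le_abs_self _).trans (hB _ _ hp2 h)
          · rw [abs_sub_comm, abs_of_nonneg (sub_nonneg.2 h)]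
            simp_rw [mul_comm (D p.1 _)]
            exact (le_abs_self _).trans (hB _ _ hp1 h)
    _ = ∫ t, ∫ r, B * Real.exp (-lam * |t - r|) ∂κ ∂κ := integral_prod _ hEi
    _ ≤ ∫ t, B * (∫ r, Real.exp (-lam * |r|)) ∂κ := by
        refine integral_mono hEi.integral_prod_left (integrable_const _) fun t => ?_
        simp only
        rw [integral_const_mul]
        refine mul_le_mul_of_nonneg_left ?_ hB0
        rw [← integral_sub_left_eq_self (fun r => Real.exp (-lam * |r|)) volume t]
        exact setIntegral_le_integral
          ((integrable_comp_sub_left (fun r => Real.exp (-lam * |r|)) t).2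
            (integrable_exp_neg_mul_abs hlam)) (Eventually.of_forall fun _ => (Real.exp_pos _).le)
    _ = B * (∫ r, Real.exp (-lam * |r|)) * T := by
        rw [integral_const, hκ, measureReal_restrict_apply_univ, Real.volume_real_Ioc_of_le hT,
          smul_eq_mul, sub_zero, mul_comm]

/-- A strong law of large numbers for processes with exponential decay of correlations. -/
theorem ae_tendsto_average_zero {ν : Measure Ω} [IsFiniteMeasure ν] {D : ℝ → Ω → ℝ}
    (hD : Measurable (Function.uncurry D)) {C : ℝ} (hC : ∀ t s, |D t s| ≤ C) {B lam : ℝ}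
    (hlam : 0 < lam)
    (hB : ∀ r t, 0 ≤ r → r ≤ t → |∫ s, D t s * D r s ∂ν| ≤ B * Real.exp (-lam * (t - r))) :
    ∀ᵐ s ∂ν, Tendsto (fun T : ℝ => T⁻¹ * ∫ t in (0 : ℝ)..T, D t s) atTop (𝓝 0) := by
  set S : ℝ → Ω → ℝ := fun T s => ∫ t in (0 : ℝ)..T, D t s with hS
  set M := B * ∫ r, Real.exp (-lam * |r|) with hM
  have hSm : ∀ T, 0 ≤ T → Measurable (S T) := fun T hT => by
    simp only [hS, intervalIntegral.integral_of_le hT]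
    exact ((hD.comp measurable_swap).stronglyMeasurable.integral_prod_right' (f := fun p : Ω × ℝ =>
      D p.2 p.1)).measurable
  have hSb : ∀ T s, |S T s| ≤ C * |T| := fun T s => by
    have := intervalIntegral.norm_integral_le_of_norm_le_const
      (a := 0) (b := T) (f := fun t => D t s) (C := C) (fun t _ => hC t s)
    simpa using this
  -- The average over [0,T] has second moment O(1/T). At T = k² this is summable, so the sum of the
  -- squared averages is almost everywhere finite and its terms tend to 0.
  have hmom : ∀ k : ℕ, ∫⁻ s, ENNReal.ofReal ((((k : ℝ) ^ 2)⁻¹ * S ((k : ℝ) ^ 2) s) ^ 2) ∂ν ≤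
      ENNReal.ofReal (M * ((k : ℝ) ^ 2)⁻¹) := fun k => by
    rw [← ofReal_integral_eq_lintegral_ofReal]
    · refine ENNReal.ofReal_le_ofReal ?_
      simp_rw [mul_pow]
      rw [integral_const_mul]
      rcases Nat.eq_zero_or_pos k with rfl | hk
      · simp
      have hk0 : (0 : ℝ) < k := by exact_mod_cast hk
      calc (((k : ℝ) ^ 2)⁻¹) ^ 2 * ∫ s, S ((k : ℝ) ^ 2) s ^ 2 ∂ν
          ≤ (((k : ℝ) ^ 2)⁻¹) ^ 2 * (M * (k : ℝ) ^ 2) := by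
            gcongr
            exact integral_sq_integral_le hD hC hlam hB (by positivity)
        _ = M * ((k : ℝ) ^ 2)⁻¹ := by field_simp
    · refine Integrable.of_bound
        (((hSm _ (by positivity)).const_mul _).pow_const 2).aestronglyMeasurable
        ((((k : ℝ) ^ 2)⁻¹ * (C * |(k : ℝ) ^ 2|)) ^ 2) (Eventually.of_forall fun s => ?_)
      rw [norm_pow, norm_mul, Real.norm_eq_abs, Real.norm_eq_abs, abs_of_nonneg (a := (_)⁻¹)
        (by positivity)]
      gcongr
      exact hSb _ s
    · exact Eventually.of_forall fun s => sq_nonneg _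
  have hsum : ∫⁻ s, ∑' k : ℕ, ENNReal.ofReal ((((k : ℝ) ^ 2)⁻¹ * S ((k : ℝ) ^ 2) s) ^ 2) ∂ν ≠ ⊤ := by
    rw [lintegral_tsum fun k =>
      (((hSm _ (by positivity)).const_mul _).pow_const 2).ennreal_ofReal.aemeasurable]
    refine ((ENNReal.tsum_le_tsum hmom).trans_lt ?_).ne
    have : Summable fun k : ℕ => M * ((k : ℝ) ^ 2)⁻¹ :=
      (Real.summable_nat_pow_inv.2 one_lt_two).mul_left M
    exact this.tsum_ofReal_lt_top
  have hae := ae_lt_top (Measurable.tsum fun k =>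
    (((hSm _ (by positivity)).const_mul _).pow_const 2).ennreal_ofReal) hsum
  filter_upwards [hae] with s hs
  refine tendsto_average_of_squares (hD.comp (measurable_id.prodMk measurable_const))
    (fun t => hC t s) ?_
  have h0 := ENNReal.tendsto_atTop_zero_of_tsum_ne_top hs.ne
  have h1 := (ENNReal.tendsto_toReal ENNReal.zero_ne_top).comp h0
  simp only [Function.comp_def, ENNReal.toReal_ofReal (sq_nonneg _), ENNReal.toReal_zero] at h1
  have h2 := h1.sqrt
  simp only [Real.sqrt_sq_eq_abs, Real.sqrt_zero] at h2
  exact (tendsto_zero_iff_abs_tendsto_zero _).2 h2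

/-! ### Increments at an exponentially shrinking scale. -/

/-- Increments of a bounded function over `[0,1]`, tested against a bounded function which varies
slowly: the increment is moved to the test function. -/
theorem abs_integral_increment_mul_le {u v : ℝ → ℝ} (hu : Measurable u) (hv : Measurable v)
    {C C' E τ : ℝ} (hC : ∀ s, |u s| ≤ C) (hC' : ∀ s, |v s| ≤ C')
    (hE : ∀ s, |v s - v (s - τ)| ≤ E) :
    |∫ s in (0 : ℝ)..1, (u s - u (s + τ)) * v s| ≤ C * E + 2 * (C * C' * |τ|) := by
  have hC0 : 0 ≤ C := (abs_nonneg _).trans (hC 0)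
  have hC0' : 0 ≤ C' := (abs_nonneg _).trans (hC' 0)
  have hint : ∀ {w : ℝ → ℝ} {K : ℝ}, Measurable w → (∀ s, |w s| ≤ K) →
      ∀ p q : ℝ, IntervalIntegrable w volume p q := fun {w K} hw hK p q => by
    rw [intervalIntegrable_iff]
    exact Measure.integrableOn_of_bounded (M := K) measure_Ioc_lt_top.ne
      hw.aestronglyMeasurable (Eventually.of_forall fun t => hK t)
  have hbd : ∀ s t, |u s * v t| ≤ C * C' := fun s t => by
    rw [abs_mul]
    exact mul_le_mul (hC s) (hC' t) (abs_nonneg _) hC0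
  have hvτ : Measurable fun s => v (s - τ) := hv.comp (measurable_id.sub_const τ)
  have huτ : Measurable fun s => u (s + τ) := hu.comp (measurable_id.add_const τ)
  have i1 : ∀ p q, IntervalIntegrable (fun s => u s * v s) volume p q :=
    hint (hu.mul hv) fun s => hbd s s
  have i2 : ∀ p q, IntervalIntegrable (fun s => u s * v (s - τ)) volume p q :=
    hint (hu.mul hvτ) fun s => hbd s (s - τ)
  have i3 : ∀ p q, IntervalIntegrable (fun s => u (s + τ) * v s) volume p q :=
    hint (huτ.mul hv) fun s => hbd (s + τ) s
  have e1 : ∫ s in (0 : ℝ)..1, u (s + τ) * v s = ∫ s in (0 + τ)..(1 + τ), u s * v (s - τ) := by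
    rw [← intervalIntegral.integral_comp_add_right (fun s => u s * v (s - τ)) τ]
    simp
  -- After translation the shift acts on v. The price is two boundary integrals over intervals of
  -- length |τ|.
  have e2 : ∫ s in (0 : ℝ)..1, (u s - u (s + τ)) * v s =
      (∫ s in (0 : ℝ)..1, u s * (v s - v (s - τ))) +
        ((∫ s in (0 : ℝ)..(0 + τ), u s * v (s - τ)) -
          ∫ s in (1 : ℝ)..(1 + τ), u s * v (s - τ)) := by
    rw [intervalIntegral.integral_interval_sub_interval_comm (i2 _ _) (i2 _ _) (i2 _ _), ← e1]
    simp only [sub_mul, mul_sub]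
    rw [intervalIntegral.integral_sub (i1 _ _) (i3 _ _),
      intervalIntegral.integral_sub (i1 _ _) (i2 _ _)]
    ring
  have b1 : |∫ s in (0 : ℝ)..1, u s * (v s - v (s - τ))| ≤ C * E := by
    have := intervalIntegral.norm_integral_le_of_norm_le_const (a := 0) (b := 1)
      (f := fun s => u s * (v s - v (s - τ))) (C := C * E) (fun s _ => by
        rw [norm_mul]
        exact mul_le_mul (hC s) (hE s) (abs_nonneg _) hC0)
    simpa using this
  have b2 : ∀ p : ℝ, |∫ s in p..(p + τ), u s * v (s - τ)| ≤ C * C' * |τ| := fun p => by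
    have := intervalIntegral.norm_integral_le_of_norm_le_const (a := p) (b := p + τ)
      (f := fun s => u s * v (s - τ)) (C := C * C') (fun s _ => hbd s (s - τ))
    simpa using this
  rw [e2]
  have := abs_add_le (∫ s in (0 : ℝ)..1, u s * (v s - v (s - τ)))
    ((∫ s in (0 : ℝ)..(0 + τ), u s * v (s - τ)) - ∫ s in (1 : ℝ)..(1 + τ), u s * v (s - τ))
  have h3 := abs_sub (∫ s in (0 : ℝ)..(0 + τ), u s * v (s - τ))
    (∫ s in (1 : ℝ)..(1 + τ), u s * v (s - τ))
  have := b2 0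
  have := b2 1
  linarith

/-- If `g t` is bounded and Lipschitz at the scale `exp (-lam * t)`, its increments at this scale
average out over time, almost everywhere. -/
theorem ae_tendsto_average_increment {g : ℝ → ℝ → ℝ} (hg : Continuous (Function.uncurry g))
    {C K lam : ℝ} (hlam : 0 < lam) (hC : ∀ t s, |g t s| ≤ C)
    (hK : ∀ t, 0 ≤ t → ∀ s s', |g t s - g t s'| ≤ K * Real.exp (lam * t) * |s - s'|) (x : ℝ) :
    ∀ᵐ s ∂(volume.restrict (Icc (0 : ℝ) 1)), Tendsto (fun T : ℝ =>
      T⁻¹ * ∫ t in (0 : ℝ)..T, (g t s - g t (s + x * Real.exp (-lam * t)))) atTop (𝓝 0) := by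
  have hC0 : 0 ≤ C := (abs_nonneg _).trans (hC 0 0)
  have hgt : ∀ t, Continuous (g t) := fun t =>
    hg.comp (continuous_const.prodMk continuous_id)
  have hDb : ∀ t s, |g t s - g t (s + x * Real.exp (-lam * t))| ≤ 2 * C := fun t s => by
    have := abs_sub (g t s) (g t (s + x * Real.exp (-lam * t)))
    linarith [hC t s, hC t (s + x * Real.exp (-lam * t))]
  have hDc : Continuous fun p : ℝ × ℝ => g p.1 p.2 - g p.1 (p.2 + x * Real.exp (-lam * p.1)) := by
    refine hg.sub (hg.comp (f := fun p : ℝ × ℝ => (p.1, p.2 + x * Real.exp (-lam * p.1))) ?_)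
    fun_prop
  refine ae_tendsto_average_zero (ν := volume.restrict (Icc (0 : ℝ) 1))
    (D := fun t s => g t s - g t (s + x * Real.exp (-lam * t)))
    hDc.measurable (C := 2 * C) hDb hlam
    -- The first summand comes from the variation of D_r under the shift x e^{-lam t}. The second
    -- comes from the boundary terms, where |τ| = |x| e^{-lam t} ≤ |x| e^{-lam (t-r)} because r ≥ 0.
    (B := C * (2 * (K * |x|)) + 2 * (C * (2 * C) * |x|)) ?_
  intro r t hr hrt
  have hD : ∀ t, Measurable fun s => g t s - g t (s + x * Real.exp (-lam * t)) := fun t =>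
    ((hgt t).sub ((hgt t).comp (continuous_id.add continuous_const))).measurable
  rw [integral_Icc_eq_integral_Ioc, ← intervalIntegral.integral_of_le zero_le_one]
  refine (abs_integral_increment_mul_le (hgt t).measurable (hD r) (hC t) (hDb r)
    (E := 2 * (K * |x|) * Real.exp (-lam * (t - r))) fun s => ?_).trans ?_
  · have h1 := hK r hr s (s - x * Real.exp (-lam * t))
    have h2 := hK r hr (s + x * Real.exp (-lam * r))
      (s - x * Real.exp (-lam * t) + x * Real.exp (-lam * r))
    have e : K * Real.exp (lam * r) * |x * Real.exp (-lam * t)| =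
        K * |x| * Real.exp (-lam * (t - r)) := by
      rw [abs_mul, abs_of_pos (Real.exp_pos _), show -lam * (t - r) = lam * r + -lam * t by ring,
        Real.exp_add]
      ring
    rw [sub_sub_cancel, e] at h1
    rw [show s + x * Real.exp (-lam * r) -
      (s - x * Real.exp (-lam * t) + x * Real.exp (-lam * r)) = x * Real.exp (-lam * t) by ring,
      e] at h2
    rw [show g r s - g r (s + x * Real.exp (-lam * r)) - (g r (s - x * Real.exp (-lam * t)) -
      g r (s - x * Real.exp (-lam * t) + x * Real.exp (-lam * r))) =
      (g r s - g r (s - x * Real.exp (-lam * t))) - (g r (s + x * Real.exp (-lam * r)) -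
      g r (s - x * Real.exp (-lam * t) + x * Real.exp (-lam * r))) by ring]
    refine (abs_sub _ _).trans ?_
    linarith
  · have hexp : Real.exp (-lam * t) ≤ Real.exp (-lam * (t - r)) :=
      Real.exp_le_exp.2 (by nlinarith)
    rw [abs_mul, abs_of_pos (Real.exp_pos _), add_mul]
    have : C * (2 * C) * (|x| * Real.exp (-lam * t)) ≤
        C * (2 * C) * (|x| * Real.exp (-lam * (t - r))) := by gcongr
    linarith

/-! ### Approximation by Lipschitz functions and stability of averages. -/

/-- Compactly supported continuous functions are uniform limits of functions which are Lipschitz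
along the action of `SL_d(ℝ)`. -/
theorem exists_lipschitz_approx {ι : Type*} [Fintype ι] [DecidableEq ι] {Z : Type*}
    [TopologicalSpace Z] [MulAction (Matrix.SpecialLinearGroup ι ℝ) Z]
    [ContinuousSMul (Matrix.SpecialLinearGroup ι ℝ) Z] (f : C_c(Z, ℝ)) {ε : ℝ} (hε : 0 < ε) :
    ∃ (F : Z → ℝ) (k C : ℝ), 0 ≤ k ∧ (∀ y, |F y| ≤ C) ∧
      (∀ (h : Matrix.SpecialLinearGroup ι ℝ) y, |F (h • y) - F y| ≤ k * len h) ∧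
      ∀ y, |f y - F y| ≤ ε := by
  obtain ⟨M, hM⟩ := f.hasCompactSupport.exists_bound_of_continuous f.continuous
  replace hM : ∀ y, |f y| ≤ M := hM
  obtain ⟨δ, hδ, hU⟩ := exists_len_lt_subset
    (eventually_forall_abs_smul_sub_lt (H := Matrix.SpecialLinearGroup ι ℝ) f hε)
  -- F is the sup-convolution of f with the penalty k · len. With this k the penalty outweighs the
  -- oscillation 2|M| of f once len g ≥ δ, so only g with len g < δ matter, and there f moves by
  -- less than ε.
  set k : ℝ := 2 * |M| / δ with hk
  have hk0 : 0 ≤ k := by positivity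
  have hkδ : k * δ = 2 * |M| := div_mul_cancel₀ _ hδ.ne'
  set F : Z → ℝ := fun y => ⨆ g : Matrix.SpecialLinearGroup ι ℝ, (f (g • y) - k * len g) with hF
  have hbdd : ∀ y, BddAbove (range fun g : Matrix.SpecialLinearGroup ι ℝ =>
      f (g • y) - k * len g) := fun y => by
    refine ⟨M, ?_⟩
    rintro _ ⟨g, rfl⟩
    have := mul_nonneg hk0 (len_nonneg g)
    have := le_abs_self (f (g • y))
    have := hM (g • y)
    simp only
    linarith
  have hle : ∀ y, f y ≤ F y := fun y => by
    simpa [len_one] using le_ciSup (hbdd y) 1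
  have hge : ∀ y, F y ≤ f y + ε := fun y => by
    refine ciSup_le fun g => ?_
    have h0 := mul_nonneg hk0 (len_nonneg g)
    rcases lt_or_ge (len g) δ with h | h
    · have := (abs_lt.1 (hU g h y)).2
      linarith
    · have h1 : k * δ ≤ k * len g := mul_le_mul_of_nonneg_left h hk0
      have h2 := (abs_le.1 (hM y)).1
      have h3 := (abs_le.1 (hM (g • y))).2
      have h4 := le_abs_self M
      linarith
  have hlip : ∀ (h : Matrix.SpecialLinearGroup ι ℝ) y, F (h • y) ≤ F y + k * len h := by
    intro h y
    refine ciSup_le fun g => ?_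
    -- Using g * h as competitor at y costs at most k · len h more, by subadditivity of `len`.
    have h1 := le_ciSup (hbdd y) (g * h)
    have h2 := mul_le_mul_of_nonneg_left (len_mul_le g h) hk0
    simp only [mul_smul] at h1
    linarith
  refine ⟨F, k, M + ε, hk0, fun y => ?_, fun h y => ?_, fun y => ?_⟩
  · have := abs_le.1 (hM y)
    exact abs_le.2 ⟨by linarith [hle y], by linarith [hge y]⟩
  · have h1 := hlip h y
    have h2 := hlip h⁻¹ (h • y)
    rw [inv_smul_smul, len_inv] at h2
    exact abs_le.2 ⟨by linarith, by linarith⟩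
  · exact abs_le.2 ⟨by linarith [hge y], by linarith [hle y]⟩

/-- Averages tend to zero if the function is approximated, for large times, by functions whose
averages tend to zero. -/
theorem tendsto_average_of_approx {v : ℝ → ℝ} (hv : Continuous v)
    (h : ∀ ε > 0, ∃ w : ℝ → ℝ, Continuous w ∧ (∀ᶠ t in atTop, |v t - w t| ≤ ε) ∧
      Tendsto (fun T : ℝ => T⁻¹ * ∫ t in (0 : ℝ)..T, w t) atTop (𝓝 0)) :
    Tendsto (fun T : ℝ => T⁻¹ * ∫ t in (0 : ℝ)..T, v t) atTop (𝓝 0) := by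
  rw [Metric.tendsto_atTop']
  intro ε hε
  obtain ⟨w, hw, hvw, hlim⟩ := h (ε / 3) (by positivity)
  obtain ⟨T₀, hT₀⟩ := eventually_atTop.1 hvw
  have hd : Continuous fun t => v t - w t := hv.sub hw
  have h1 : Tendsto (fun T : ℝ => T⁻¹ * |∫ t in (0 : ℝ)..(max T₀ 0), (v t - w t)|) atTop
      (𝓝 0) := by
    have := (tendsto_inv_atTop_zero (𝕜 := ℝ)).mul_const
      |∫ t in (0 : ℝ)..(max T₀ 0), (v t - w t)|
    rwa [zero_mul] at this
  have e1 := h1.eventually (gt_mem_nhds (show 0 < ε / 3 by positivity))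
  have e2 := hlim.abs.eventually (gt_mem_nhds (show |(0 : ℝ)| < ε / 3 by simpa using hε))
  obtain ⟨N, hN⟩ := eventually_atTop.1 (e1.and e2)
  refine ⟨max (max N T₀) 0, fun T hT => ?_⟩
  obtain ⟨hN1, hN2⟩ := hN T ((le_max_left _ _).trans ((le_max_left _ _).trans hT.le))
  have hTT : max T₀ 0 ≤ T := (max_le_max_right 0 (le_max_right N T₀)).trans hT.le
  have hT0 : 0 < T := (le_max_right _ _).trans_lt hT
  have hsplit := intervalIntegral.integral_add_adjacent_intervals
    (hd.intervalIntegrable (μ := volume) 0 (max T₀ 0)) (hd.intervalIntegrable (max T₀ 0) T)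
  rw [intervalIntegral.integral_sub (a := 0) (b := T) (hv.intervalIntegrable _ _)
    (hw.intervalIntegrable _ _)] at hsplit
  have hrest : |∫ t in (max T₀ 0)..T, (v t - w t)| ≤ ε / 3 * T := by
    have := intervalIntegral.norm_integral_le_of_norm_le_const (a := max T₀ 0) (b := T)
      (f := fun t => v t - w t) (C := ε / 3) (fun t ht => by
        rw [uIoc_of_le hTT] at ht
        exact hT₀ t ((le_max_left _ _).trans ht.1.le))
    rw [Real.norm_eq_abs, abs_of_nonneg (sub_nonneg.2 hTT)] at this
    refine this.trans ?_
    gcongr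
    linarith [le_max_right T₀ 0]
  have hrest' : T⁻¹ * |∫ t in (max T₀ 0)..T, (v t - w t)| ≤ ε / 3 := by
    rw [inv_mul_le_iff₀ hT0]
    linarith
  rw [Real.dist_0_eq_abs, show ∫ t in (0 : ℝ)..T, v t = (∫ t in (0 : ℝ)..T, w t) +
    ((∫ t in (0 : ℝ)..(max T₀ 0), (v t - w t)) + ∫ t in (max T₀ 0)..T, (v t - w t)) by
      rw [hsplit]; ring]
  rw [mul_add, mul_add]
  have h3 := abs_add_le (T⁻¹ * ∫ t in (0 : ℝ)..T, w t)
    (T⁻¹ * (∫ t in (0 : ℝ)..(max T₀ 0), (v t - w t)) + T⁻¹ * ∫ t in (max T₀ 0)..T, (v t - w t))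
  have h4 := abs_add_le (T⁻¹ * ∫ t in (0 : ℝ)..(max T₀ 0), (v t - w t))
    (T⁻¹ * ∫ t in (max T₀ 0)..T, (v t - w t))
  rw [abs_mul T⁻¹, abs_mul T⁻¹, abs_of_pos (inv_pos.2 hT0)] at h4
  linarith

/-! ### The diagonal flow and its expansion rate. -/

section Flow

variable {m n : ℕ}

variable (m n) in
/-- The exponents of the diagonal flow. -/
noncomputable def weight : Fin m ⊕ Fin n → ℝ := Sum.elim (fun _ => 1 / m) (fun _ => -(1 / n))

variable (m n) in
/-- The expansion rate of the diagonal flow on the horosphere. -/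
noncomputable def rate : ℝ := 1 / m + 1 / n

theorem weight_sub_le (i j) : weight m n i - weight m n j ≤ rate m n := by
  have h1 : (0 : ℝ) ≤ 1 / m := by positivity
  have h2 : (0 : ℝ) ≤ 1 / n := by positivity
  cases i <;> cases j <;> simp only [weight, rate, Sum.elim_inl, Sum.elim_inr] <;> linarith

variable [NeZero m] [NeZero n]

theorem a_mul_a (t t' : ℝ) : a m n t * a m n t' = a m n (t + t') := by
  apply Subtype.ext
  rw [Matrix.SpecialLinearGroup.coe_mul]
  simp only [a, Matrix.diagonal_mul_diagonal]
  congr 1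
  funext i
  cases i <;> simp only [Sum.elim_inl, Sum.elim_inr, ← Real.exp_add] <;> congr 1 <;> ring

theorem a_zero : a m n 0 = 1 := by
  have := a_mul_a (m := m) (n := n) 0 0
  rwa [add_zero, mul_eq_left] at this

theorem a_inv (t : ℝ) : (a m n t)⁻¹ = a m n (-t) := by
  rw [inv_eq_iff_mul_eq_one, a_mul_a, add_neg_cancel, a_zero]

theorem continuous_a : Continuous (a m n) := by
  refine Continuous.subtype_mk (Continuous.matrix_diagonal (continuous_pi fun i => ?_)) _
  cases i <;> simp only [Sum.elim_inl, Sum.elim_inr] <;> fun_prop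

variable (m n) in
theorem rate_pos : 0 < rate m n := by
  have : 0 < m := NeZero.pos m
  have : 0 < n := NeZero.pos n
  unfold rate
  positivity

theorem conj_apply (t : ℝ) (M : Matrix (Fin m ⊕ Fin n) (Fin m ⊕ Fin n) ℝ) (i j) :
    ((a m n t : Matrix (Fin m ⊕ Fin n) (Fin m ⊕ Fin n) ℝ) * M *
      ((a m n t)⁻¹ : G m n)) i j = Real.exp ((weight m n i - weight m n j) * t) * M i j := by
  rw [a_inv]
  simp only [a, Matrix.mul_diagonal, Matrix.diagonal_mul]
  rw [mul_right_comm]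
  congr 1
  cases i <;> cases j <;> simp only [Sum.elim_inl, Sum.elim_inr, ← Real.exp_add, weight] <;>
    congr 1 <;> ring

theorem entrySum_conj_le {t : ℝ} (ht : 0 ≤ t) (g : G m n) :
    entrySum (((a m n t * g * (a m n t)⁻¹ : G m n) :
      Matrix (Fin m ⊕ Fin n) (Fin m ⊕ Fin n) ℝ) - 1) ≤
      Real.exp (rate m n * t) *
        entrySum ((g : Matrix (Fin m ⊕ Fin n) (Fin m ⊕ Fin n) ℝ) - 1) := by
  have h : ((a m n t * g * (a m n t)⁻¹ : G m n) :
      Matrix (Fin m ⊕ Fin n) (Fin m ⊕ Fin n) ℝ) - 1 =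
      (a m n t : Matrix (Fin m ⊕ Fin n) (Fin m ⊕ Fin n) ℝ) *
        ((g : Matrix (Fin m ⊕ Fin n) (Fin m ⊕ Fin n) ℝ) - 1) * ((a m n t)⁻¹ : G m n) := by
    rw [mul_sub, mul_one, sub_mul, ← Matrix.SpecialLinearGroup.coe_mul,
      ← Matrix.SpecialLinearGroup.coe_mul, ← Matrix.SpecialLinearGroup.coe_mul, mul_inv_cancel,
      Matrix.SpecialLinearGroup.coe_one]
  rw [h, entrySum, entrySum, Finset.mul_sum]
  refine Finset.sum_le_sum fun i _ => ?_
  rw [Finset.mul_sum]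
  refine Finset.sum_le_sum fun j _ => ?_
  rw [conj_apply, abs_mul, abs_of_pos (Real.exp_pos _)]
  gcongr
  exact weight_sub_le i j

/-- The (i,j) entry is scaled by e^{(w_i - w_j)t}, and the largest weight difference is `rate`. This
same exponent governs the Lipschitz constants and the scale of the increments. -/
theorem dev_conj_le {t : ℝ} (ht : 0 ≤ t) (g : G m n) :
    dev (a m n t * g * (a m n t)⁻¹) ≤ Real.exp (rate m n * t) * dev g := by
  refine max_le ((entrySum_conj_le ht g).trans ?_) ?_
  · gcongr
    exact le_max_left _ _
  · rw [show (a m n t * g * (a m n t)⁻¹)⁻¹ = a m n t * g⁻¹ * (a m n t)⁻¹ by group]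
    refine (entrySum_conj_le ht g⁻¹).trans ?_
    gcongr
    exact le_max_right _ _

end Flow

/-- Since g h⁻¹ - 1 = (g - h) h⁻¹, Lipschitz bounds on the entries of a curve with bounded inverses
become bounds in the group. -/
theorem dev_mul_inv_le {ι : Type*} [Fintype ι] [DecidableEq ι]
    (g h : Matrix.SpecialLinearGroup ι ℝ) :
    dev (g * h⁻¹) ≤ entrySum (g.1 - h.1) *
      max (entrySum (g⁻¹ : Matrix.SpecialLinearGroup ι ℝ).1)
        (entrySum (h⁻¹ : Matrix.SpecialLinearGroup ι ℝ).1) := by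
  have key : ∀ g h : Matrix.SpecialLinearGroup ι ℝ,
      entrySum (((g * h⁻¹ : Matrix.SpecialLinearGroup ι ℝ) : Matrix ι ι ℝ) - 1) ≤
        entrySum (g.1 - h.1) *
          entrySum (h⁻¹ : Matrix.SpecialLinearGroup ι ℝ).1 := fun g h => by
    refine le_of_eq_of_le ?_ (entrySum_mul_le _ _)
    rw [sub_mul, ← Matrix.SpecialLinearGroup.coe_mul, ← Matrix.SpecialLinearGroup.coe_mul,
      mul_inv_cancel, Matrix.SpecialLinearGroup.coe_one]
  have hs : entrySum (h.1 - g.1) = entrySum (g.1 - h.1) := by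
    simp only [entrySum, Matrix.sub_apply, abs_sub_comm]
  refine max_le ((key g h).trans ?_) ?_
  · gcongr
    · exact entrySum_nonneg _
    · exact le_max_right _ _
  · rw [mul_inv_rev, inv_inv]
    refine (key h g).trans ?_
    rw [hs]
    gcongr
    · exact entrySum_nonneg _
    · exact le_max_left _ _

/-! ### Averages along the translated curve. -/

section Orbit

variable {m n : ℕ}

theorem continuous_of_lipschitz {F : X m n → ℝ} {k : ℝ}
    (hF : ∀ (h : G m n) y, |F (h • y) - F y| ≤ k * len h) (Λ : X m n) :
    Continuous fun g : G m n => F (g • Λ) := by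
  rw [continuous_iff_continuousAt]
  intro g₀
  rw [ContinuousAt, tendsto_iff_dist_tendsto_zero]
  have h1 : Continuous fun g : G m n => |k| * dev (g * g₀⁻¹) :=
    continuous_const.mul (continuous_dev.comp (continuous_id.mul continuous_const))
  have h2 := h1.tendsto g₀
  rw [mul_inv_cancel, dev_one, mul_zero] at h2
  refine squeeze_zero (fun _ => dist_nonneg) (fun g => ?_) h2
  have h3 := hF (g * g₀⁻¹) (g₀ • Λ)
  rw [smul_smul, inv_mul_cancel_right] at h3
  rw [Real.dist_eq]
  refine h3.trans ((mul_le_mul_of_nonneg_right (le_abs_self k) (len_nonneg _)).trans ?_)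
  exact mul_le_mul_of_nonneg_left (len_le_dev _) (abs_nonneg _)

variable [NeZero m] [NeZero n]

/-- Along a Lipschitz curve `ψ`, the function `f (a_t ψ(s) Λ)` and its increment at the scale
contracted by `a_t` have the same time averages, for almost every `s`. -/
theorem ae_tendsto_average_orbit {ψ : ℝ → G m n} (hψ : Continuous ψ) {K B : ℝ}
    (hK : ∀ s s', entrySum ((ψ s).1 - (ψ s').1) ≤ K * |s - s'|)
    (hB : ∀ s, entrySum ((ψ s)⁻¹ : G m n).1 ≤ B) (Λ : X m n) (f : C_c(X m n, ℝ)) (x : ℝ) :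
    ∀ᵐ s ∂(volume.restrict (Icc (0 : ℝ) 1)), Tendsto (fun T : ℝ =>
      T⁻¹ * ∫ t in (0 : ℝ)..T, (f (a m n t • ψ s • Λ) -
        f (a m n t • ψ (s + x * Real.exp (-rate m n * t)) • Λ))) atTop (𝓝 0) := by
  have hB0 : 0 ≤ B := (entrySum_nonneg _).trans (hB 0)
  have hcurve : ∀ s : ℝ,
      Continuous fun t => a m n t * ψ (s + x * Real.exp (-rate m n * t)) := fun s =>
    continuous_a.mul (hψ.comp (by fun_prop))
  have hcurve0 : ∀ s : ℝ, Continuous fun t => a m n t * ψ s := fun s =>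
    continuous_a.mul continuous_const
  choose F k C hk hC hF hfF using fun j : ℕ => exists_lipschitz_approx
    (ι := Fin m ⊕ Fin n) f (ε := 1 / ((j : ℝ) + 1)) (by positivity)
  have hFc : ∀ j, Continuous fun g : G m n => F j (g • Λ) := fun j =>
    continuous_of_lipschitz (hF j) Λ
  have hae : ∀ᵐ s ∂(volume.restrict (Icc (0 : ℝ) 1)), ∀ j, Tendsto (fun T : ℝ =>
      T⁻¹ * ∫ t in (0 : ℝ)..T, (F j ((a m n t * ψ s) • Λ) -
        F j ((a m n t * ψ (s + x * Real.exp (-rate m n * t))) • Λ))) atTop (𝓝 0) := by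
    refine ae_all_iff.2 fun j => ?_
    refine ae_tendsto_average_increment (g := fun t s => F j ((a m n t * ψ s) • Λ))
      ?_ (C := C j) (K := k j * (K * B)) (rate_pos m n) (fun t s => hC j _) ?_ x
    · exact (hFc j).comp ((continuous_a.comp continuous_fst).mul (hψ.comp continuous_snd))
    · intro t ht s s'
      -- The two orbit points differ by the conjugate of ψ(s) ψ(s')⁻¹, whose deviation from 1 grows
      -- at most like e^{rate · t}.
      have h1 := hF j (a m n t * (ψ s * (ψ s')⁻¹) * (a m n t)⁻¹) ((a m n t * ψ s') • Λ)
      rw [smul_smul, show a m n t * (ψ s * (ψ s')⁻¹) * (a m n t)⁻¹ * (a m n t * ψ s') =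
        a m n t * ψ s by group] at h1
      refine h1.trans ?_
      calc k j * len (a m n t * (ψ s * (ψ s')⁻¹) * (a m n t)⁻¹)
          ≤ k j * (Real.exp (rate m n * t) * (K * |s - s'| * B)) := by
            refine mul_le_mul_of_nonneg_left ?_ (hk j)
            refine (len_le_dev _).trans ((dev_conj_le ht _).trans ?_)
            gcongr
            refine (dev_mul_inv_le _ _).trans ?_
            exact mul_le_mul (hK s s') (max_le (hB s) (hB s'))
              ((entrySum_nonneg _).trans (le_max_left _ _)) ((entrySum_nonneg _).trans (hK s s'))
        _ = k j * (K * B) * Real.exp (rate m n * t) * |s - s'| := by ring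
  filter_upwards [hae] with s hs
  simp only [smul_smul]
  have hfc : Continuous fun g : G m n => f (g • Λ) :=
    f.continuous.comp (continuous_id.smul continuous_const)
  refine tendsto_average_of_approx
    ((hfc.comp (hcurve0 s)).sub (hfc.comp (hcurve s))) fun ε hε => ?_
  obtain ⟨j, hj⟩ := exists_nat_one_div_lt (show 0 < ε / 2 by positivity)
  refine ⟨fun t => F j ((a m n t * ψ s) • Λ) -
    F j ((a m n t * ψ (s + x * Real.exp (-rate m n * t))) • Λ), ((hFc j).comp (hcurve0 s)).sub ((hFc j).comp (hcurve s)),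
    Eventually.of_forall fun t => ?_, hs j⟩
  have h1 := hfF j ((a m n t * ψ s) • Λ)
  have h2 := hfF j ((a m n t * ψ (s + x * Real.exp (-rate m n * t))) • Λ)
  rw [abs_le] at h1 h2 ⊢
  constructor <;> linarith

end Orbit

/-! ### Matrix exponentials, determinants and logarithms. -/

section Exponential

variable {ι : Type*} [Fintype ι] [DecidableEq ι]

theorem map_exp_to_matrix {A : Type*} [NormedRing A] [NormedAlgebra ℝ A]
    [FiniteDimensional ℝ A] (f : A →ₐ[ℝ] Matrix ι ι ℝ) (x : A) :
    f (NormedSpace.exp x) = NormedSpace.exp (f x) := by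
  have : CompleteSpace A := FiniteDimensional.complete ℝ A
  have hf : Continuous f := f.toLinearMap.continuous_of_finiteDimensional
  rw [NormedSpace.exp_eq_tsum ℝ, NormedSpace.exp_eq_tsum ℝ]
  have hs : Summable fun k : ℕ => ((k.factorial : ℝ)⁻¹) • x ^ k :=
    NormedSpace.expSeries_summable' (𝕂 := ℝ) x
  have := hs.map_tsum (f : A →+* Matrix ι ι ℝ).toAddMonoidHom hf
  simpa using this

variable (ι) in
/-- Matrices as continuous endomorphisms of `ℝ^ι`. -/
noncomputable def toEndo : Matrix ι ι ℝ ≃ₐ[ℝ] ((ι → ℝ) →L[ℝ] (ι → ℝ)) :=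
  Matrix.toLinAlgEquiv'.trans (Module.End.toContinuousLinearMap (ι → ℝ))

theorem exp_eq_toEndo (M : Matrix ι ι ℝ) :
    NormedSpace.exp M = (toEndo ι).symm (NormedSpace.exp (toEndo ι M)) := by
  have := map_exp_to_matrix (toEndo ι).symm.toAlgHom (toEndo ι M)
  simpa using this.symm

theorem hasDerivAt_exp_smul_apply (M : Matrix ι ι ℝ) (i j : ι) :
    HasDerivAt (fun t : ℝ => NormedSpace.exp (t • M) i j) (M i j) 0 := by
  have h1 : HasDerivAt (fun t : ℝ => NormedSpace.exp (t • toEndo ι M)) (toEndo ι M) 0 := by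
    simpa using hasDerivAt_exp_smul_const (𝕂 := ℝ) (toEndo ι M) (0 : ℝ)
  let c : ((ι → ℝ) →L[ℝ] (ι → ℝ)) →L[ℝ] ℝ := LinearMap.toContinuousLinearMap
    ((LinearMap.proj j ∘ₗ LinearMap.proj i : (ι → ι → ℝ) →ₗ[ℝ] ℝ) ∘ₗ
      (toEndo ι).symm.toLinearMap)
  have h2 := c.hasFDerivAt.comp_hasDerivAt (0 : ℝ) h1
  have e : ∀ T, c T = (toEndo ι).symm T i j := fun T => rfl
  simp only [Function.comp_def, e, AlgEquiv.symm_apply_apply] at h2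
  refine h2.congr_of_eventuallyEq (Eventually.of_forall fun t => ?_)
  simp only
  rw [exp_eq_toEndo, map_smul]

/-- Differentiate the Leibniz formula at the identity. A permutation σ ≠ 1 moves at least two
indices, so each term of the product rule keeps a vanishing off-diagonal factor. -/
theorem hasDerivAt_det_exp_smul (M : Matrix ι ι ℝ) :
    HasDerivAt (fun t : ℝ => (NormedSpace.exp (t • M)).det) M.trace 0 := by
  have h : ∀ σ : Equiv.Perm ι, HasDerivAt
      (fun t : ℝ => ((Equiv.Perm.sign σ : ℤ) : ℝ) * ∏ i, NormedSpace.exp (t • M) (σ i) i)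
      (if σ = 1 then M.trace else 0) 0 := by
    intro σ
    have h1 := (HasDerivAt.fun_finsetProd (u := Finset.univ)
      (fun i _ => hasDerivAt_exp_smul_apply M (σ i) i)).const_mul ((Equiv.Perm.sign σ : ℤ) : ℝ)
    convert! h1 using 1
    simp only [zero_smul, NormedSpace.exp_zero, smul_eq_mul]
    split_ifs with hσ
    · subst hσ
      simp only [Matrix.trace, Matrix.diag_apply, Equiv.Perm.sign_one, Units.val_one, Int.cast_one,
        one_mul, Equiv.Perm.one_apply]
      refine Finset.sum_congr rfl fun i _ => ?_
      rw [Finset.prod_eq_one, one_mul]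
      exact fun j _ => Matrix.one_apply_eq j
    · symm
      refine mul_eq_zero_of_right _ (Finset.sum_eq_zero fun i _ => mul_eq_zero_of_left ?_ _)
      obtain ⟨j, hj⟩ : ∃ j, σ j ≠ j := by
        by_contra! h
        exact hσ (Equiv.ext h)
      have hj' : ∃ j ∈ Finset.univ.erase i, σ j ≠ j := by
        by_cases hji : j = i
        · subst hji
          exact ⟨σ j, by simpa using hj, fun h => hj (σ.injective h)⟩
        · exact ⟨j, by simpa using hji, hj⟩
      obtain ⟨j, hj1, hj2⟩ := hj'
      exact Finset.prod_eq_zero hj1 (Matrix.one_apply_ne hj2)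
  have h2 := HasDerivAt.fun_sum (u := Finset.univ) fun σ _ => h σ
  simpa [Matrix.det_apply'] using h2

/-- The determinant of the exponential. -/
theorem det_exp (M : Matrix ι ι ℝ) : (NormedSpace.exp M).det = Real.exp M.trace := by
  have hd := hasDerivAt_det_exp_smul M
  rw [hasDerivAt_iff_tendsto_slope] at hd
  have hk : Tendsto (fun k : ℕ => ((k : ℝ) + 1)⁻¹) atTop (𝓝[≠] 0) := by
    refine tendsto_nhdsWithin_iff.2 ⟨?_, Eventually.of_forall fun k => ?_⟩
    · simpa using tendsto_one_div_add_atTop_nhds_zero_nat (𝕜 := ℝ)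
    · have : (0 : ℝ) < ((k : ℝ) + 1)⁻¹ := by positivity
      exact this.ne'
  -- From exp M = exp(M/k)^k, the determinant equals (1 + tr M / k + o(1/k))^k, which tends to e^{tr
  -- M}. At k = 0 the zeroth power gives 1 instead.
  have hpow : ∀ k : ℕ, (NormedSpace.exp ((k : ℝ)⁻¹ • M)).det ^ k =
      if k = 0 then 1 else (NormedSpace.exp M).det := fun k => by
    rcases eq_or_ne k 0 with rfl | hk0
    · simp
    rw [if_neg hk0, ← Matrix.det_pow, ← Matrix.exp_nsmul, ← Nat.cast_smul_eq_nsmul ℝ, smul_smul,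
      mul_inv_cancel₀ (Nat.cast_ne_zero.2 hk0), one_smul]
  have hlim := Real.tendsto_one_add_pow_exp_of_tendsto
    (g := fun k : ℕ => (NormedSpace.exp ((k : ℝ)⁻¹ • M)).det - 1) (t := M.trace) (by
      rw [← tendsto_add_atTop_iff_nat 1]
      refine (hd.comp hk).congr fun k => ?_
      simp [slope_def_field, div_eq_inv_mul])
  refine tendsto_nhds_unique (tendsto_const_nhds.congr' ?_) hlim
  filter_upwards [eventually_ne_atTop 0] with k hk0
  rw [add_sub_cancel, hpow, if_neg hk0]

end Exponential

/-- A logarithm near the identity in a Banach algebra. -/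
theorem exists_log_near_one (A : Type*) [NormedRing A] [NormedAlgebra ℝ A] [CompleteSpace A] :
    ∃ log : A → A, (∀ᶠ p in 𝓝 (1 : A), NormedSpace.exp (log p) = p) ∧
      log =O[𝓝 1] fun p => p - 1 := by
  -- The derivative of exp at 0 is the identity, so the inverse function theorem supplies the
  -- logarithm and its linear bound.
  have h : HasStrictFDerivAt (NormedSpace.exp : A → A)
      ((ContinuousLinearEquiv.refl ℝ A : A ≃L[ℝ] A) : A →L[ℝ] A) 0 :=
    hasStrictFDerivAt_exp_zero (𝕂 := ℝ)
  have h1 := h.eventually_right_inverse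
  have h2 := h.to_localInverse.hasFDerivAt.isBigO_sub
  have h3 := h.localInverse_apply_image
  rw [NormedSpace.exp_zero] at h1 h2 h3
  refine ⟨h.localInverse, h1, ?_⟩
  simpa [h3] using h2

/-- Logarithms of a family of elements of a matrix algebra tending to the identity. -/
theorem exists_log_lift {ι : Type*} [Fintype ι] [DecidableEq ι] {A : Type*} [NormedRing A]
    [NormedAlgebra ℝ A] [FiniteDimensional ℝ A] (f : A →ₐ[ℝ] Matrix ι ι ℝ)
    (hf : Function.Injective f) {l : Filter ℝ} (hl : l ≤ 𝓝 0) {P : ℝ → Matrix ι ι ℝ}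
    (hP : ∀ᶠ ξ in l, P ξ ∈ range f) (hO : ∀ i j, (fun ξ => (P ξ - 1) i j) =O[l] fun ξ => ξ) :
    ∃ L : ℝ → A, (∀ᶠ ξ in l, NormedSpace.exp (f (L ξ)) = P ξ) ∧
      ∀ i j, (fun ξ => f (L ξ) i j) =O[l] fun ξ => ξ := by
  have : CompleteSpace A := FiniteDimensional.complete ℝ A
  obtain ⟨log, hlog, hlogO⟩ := exists_log_near_one A
  -- A linear left inverse of f pulls P back to A and, by expansion in matrix units, preserves the
  -- entrywise O(ξ) bound.
  obtain ⟨r, hr⟩ := f.toLinearMap.exists_leftInverse_of_injective (LinearMap.ker_eq_bot.2 hf)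
  have hr' : ∀ x, r (f x) = x := fun x => LinearMap.congr_fun hr x
  have hq : ∀ᶠ ξ in l, f (r (P ξ)) = P ξ := by
    filter_upwards [hP] with ξ ⟨x, hx⟩
    rw [← hx, hr']
  have hqO : (fun ξ => r (P ξ) - 1) =O[l] fun ξ => ξ := by
    have h2 : ∀ ξ, r (P ξ) - 1 = ∑ i, ∑ j, (P ξ - 1) i j • r (Matrix.single i j 1) := fun ξ => by
      conv_lhs => rw [← hr' 1, map_one, ← map_sub, Matrix.matrix_eq_sum_single (P ξ - 1)]
      simp only [map_sum, ← map_smul, Matrix.smul_single, smul_eq_mul, mul_one]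
    simp_rw [h2]
    refine Asymptotics.IsBigO.fun_sum fun i _ => Asymptotics.IsBigO.fun_sum fun j _ => ?_
    refine (Asymptotics.IsBigO.of_bound ‖r (Matrix.single i j 1)‖
      (Eventually.of_forall fun ξ => ?_)).trans (hO i j)
    rw [norm_smul, mul_comm]
  have hq1 : Tendsto (fun ξ => r (P ξ)) l (𝓝 1) := by
    have h1 : Tendsto (fun ξ => r (P ξ) - 1) l (𝓝 0) :=
      hqO.trans_tendsto (tendsto_id.mono_left hl)
    simpa using h1.add_const 1
  refine ⟨fun ξ => log (r (P ξ)), ?_, fun i j => ?_⟩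
  · filter_upwards [hq1.eventually hlog, hq] with ξ h1 h2
    rw [← map_exp_to_matrix, h1, h2]
  · let c : A →L[ℝ] ℝ := LinearMap.toContinuousLinearMap
      ((LinearMap.proj j ∘ₗ LinearMap.proj i : (ι → ι → ℝ) →ₗ[ℝ] ℝ) ∘ₗ f.toLinearMap)
    exact (c.isBigO_comp (fun ξ => log (r (P ξ))) l).trans ((hlogO.comp_tendsto hq1).trans hqO)

/-! ### Block triangular matrices and their logarithms. -/

section Blocks

variable {m n : ℕ}

/-- Matrices with vanishing upper right block are block triangular for this ordering. -/
def blockOrder (m n : ℕ) : Fin m ⊕ Fin n → ℕ := Sum.elim (fun _ => 1) (fun _ => 0)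

theorem blockTriangular_iff (M : Matrix (Fin m ⊕ Fin n) (Fin m ⊕ Fin n) ℝ) :
    M.BlockTriangular (blockOrder m n) ↔ M.toBlocks₁₂ = 0 := by
  constructor
  · intro h
    ext i j
    exact h (show blockOrder m n (Sum.inr j) < blockOrder m n (Sum.inl i) from zero_lt_one)
  · intro h i j hij
    rcases i with i | i <;> rcases j with j | j <;> simp [blockOrder] at hij
    exact congrFun (congrFun h i) j

theorem toBlocks₁₂_exp {M : Matrix (Fin m ⊕ Fin n) (Fin m ⊕ Fin n) ℝ} (h : M.toBlocks₁₂ = 0) :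
    (NormedSpace.exp M).toBlocks₁₂ = 0 :=
  (blockTriangular_iff _).1 ((blockTriangular_iff _).2 h).exp

/-- Logarithms of a family of block triangular matrices tending to the identity. -/
theorem exists_block_log {l : Filter ℝ} (hl : l ≤ 𝓝 0)
    {P : ℝ → Matrix (Fin m ⊕ Fin n) (Fin m ⊕ Fin n) ℝ} (hP : ∀ᶠ ξ in l, (P ξ).toBlocks₁₂ = 0)
    (hO : ∀ i j, (fun ξ => (P ξ - 1) i j) =O[l] fun ξ => ξ) :
    ∃ L : ℝ → Matrix (Fin m ⊕ Fin n) (Fin m ⊕ Fin n) ℝ,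
      (∀ᶠ ξ in l, NormedSpace.exp (L ξ) = P ξ) ∧ (∀ ξ, (L ξ).toBlocks₁₂ = 0) ∧
      ∀ i j, (fun ξ => L ξ i j) =O[l] fun ξ => ξ := by
  -- The logarithm is taken inside the subalgebra of block triangular endomorphisms, so its upper
  -- right block vanishes automatically.
  obtain ⟨S, hS⟩ : ∃ S : Subalgebra ℝ ((Fin m ⊕ Fin n → ℝ) →L[ℝ] (Fin m ⊕ Fin n → ℝ)),
      ∀ T, T ∈ S ↔ ((toEndo (Fin m ⊕ Fin n)).symm T).toBlocks₁₂ = 0 :=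
    ⟨(Matrix.blockTriangularSubalgebra ℝ ℝ (blockOrder m n)).comap
      (toEndo (Fin m ⊕ Fin n)).symm.toAlgHom, fun T => blockTriangular_iff _⟩
  obtain ⟨f, hf⟩ : ∃ f : S →ₐ[ℝ] Matrix (Fin m ⊕ Fin n) (Fin m ⊕ Fin n) ℝ,
      ∀ p, f p = (toEndo (Fin m ⊕ Fin n)).symm p.1 :=
    ⟨(toEndo (Fin m ⊕ Fin n)).symm.toAlgHom.comp S.val, fun p => rfl⟩
  have hfi : Function.Injective f := fun p p' h => by
    rw [hf, hf] at h
    exact Subtype.ext ((toEndo (Fin m ⊕ Fin n)).symm.injective h)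
  have hrange : ∀ᶠ ξ in l, P ξ ∈ range f := hP.mono fun ξ hξ => by
    have h : (toEndo (Fin m ⊕ Fin n)).symm (toEndo (Fin m ⊕ Fin n) (P ξ)) = P ξ :=
      AlgEquiv.symm_apply_apply _ _
    exact ⟨⟨_, (hS _).2 (h.symm ▸ hξ)⟩, (hf _).trans h⟩
  have : FiniteDimensional ℝ S := inferInstance
  obtain ⟨L, h1, h2⟩ := exists_log_lift (A := S) f hfi hl hrange hO
  exact ⟨fun ξ => f (L ξ), h1, fun ξ => by
    simpa only [hf] using (hS _).1 (L ξ).2, h2⟩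

end Blocks

section Asymptotics

variable {α β γ : Type*} [Fintype β]

theorem isBigO_matrix_mul {l : Filter ℝ} {U : ℝ → Matrix α β ℝ} {V : ℝ → Matrix β γ ℝ} {p q : ℕ}
    (hU : ∀ i j, (fun ξ => U ξ i j) =O[l] fun ξ => ξ ^ p)
    (hV : ∀ i j, (fun ξ => V ξ i j) =O[l] fun ξ => ξ ^ q) (i j) :
    (fun ξ => (U ξ * V ξ) i j) =O[l] fun ξ => ξ ^ (p + q) := by
  simp only [Matrix.mul_apply, pow_add]
  exact Asymptotics.IsBigO.fun_sum fun k _ => (hU i k).mul (hV k j)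

end Asymptotics

/-! ### Existence and uniqueness of the horospherical tangent. -/

variable {m n : ℕ}

/-- The parameters `ξ` with `s + ξ ∈ [0,1]`. -/
def offsets (s : ℝ) : Set ℝ := {ξ : ℝ | s + ξ ∈ Icc (0 : ℝ) 1}

/-- The matrix of `φ(s + ξ) φ(s)⁻¹`. -/
def increment (φ : ℝ → G m n) (s ξ : ℝ) : Matrix (Fin m ⊕ Fin n) (Fin m ⊕ Fin n) ℝ :=
  (φ (s + ξ) * (φ s)⁻¹ : G m n)

theorem neBot_nhdsWithin_offsets {s : ℝ} (hs : s ∈ Icc (0 : ℝ) 1) :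
    (𝓝[offsets s \ {0}] 0).NeBot := by
  rcases lt_or_ge s 1 with h | h
  · refine neBot_of_le (f := 𝓝[>] 0) (le_inf (nhdsWithin_le_nhds) (le_principal_iff.2 ?_))
    filter_upwards [Ioo_mem_nhdsGT (sub_pos.2 h)] with ξ hξ
    exact ⟨⟨by linarith [hs.1, hξ.1], by linarith [hξ.2]⟩, hξ.1.ne'⟩
  · refine neBot_of_le (f := 𝓝[<] 0) (le_inf (nhdsWithin_le_nhds) (le_principal_iff.2 ?_))
    filter_upwards [Ioo_mem_nhdsLT (show (-1 : ℝ) < 0 by norm_num)] with ξ hξ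
    exact ⟨⟨by linarith [hξ.1], by linarith [hs.2, hξ.2]⟩, hξ.2.ne⟩

/-- Second order expansion of an analytic curve. -/
theorem exists_increment_expansion {φ : ℝ → G m n} (hφ : IsAnalyticCurve φ) {s : ℝ}
    (hs : s ∈ Icc (0 : ℝ) 1) :
    ∃ A : Matrix (Fin m ⊕ Fin n) (Fin m ⊕ Fin n) ℝ, ∀ i j,
      (fun ξ => (increment φ s ξ - 1 - ξ • A) i j) =O[𝓝[offsets s] 0] fun ξ => ξ ^ 2 := by
  have h : ∀ i j, ∃ c : ℝ, (fun ξ => (φ (s + ξ)).1 i j - (φ s).1 i j - ξ * c)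
      =O[𝓝[offsets s] 0] fun ξ => ξ ^ 2 := by
    intro i j
    obtain ⟨p, hp⟩ := hφ i j s hs
    refine ⟨p 1 fun _ => 1, ?_⟩
    have h1 := hp.isBigO_sub_partialSum_pow 2
    rw [insert_eq_of_mem hs] at h1
    have e : ∀ ξ : ℝ, p.partialSum 2 ξ = (φ s).1 i j + ξ * p 1 fun _ => 1 := fun ξ => by
      rw [FormalMultilinearSeries.partialSum, Finset.sum_range_succ, Finset.sum_range_one,
        hp.coeff_zero]
      congr 1
      simp
    simp only [e, ← sub_sub] at h1
    refine h1.trans (Asymptotics.IsBigO.of_bound 1 (Eventually.of_forall fun ξ => ?_))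
    simp
  choose c hc using h
  refine ⟨Matrix.of c * ((φ s)⁻¹ : G m n).1, fun i j => ?_⟩
  have e : ∀ ξ, increment φ s ξ - 1 - ξ • (Matrix.of c * ((φ s)⁻¹ : G m n).1) =
      ((φ (s + ξ)).1 - (φ s).1 - ξ • Matrix.of c) * ((φ s)⁻¹ : G m n).1 := fun ξ => by
    rw [sub_mul, sub_mul, Matrix.smul_mul, increment, Matrix.SpecialLinearGroup.coe_mul,
      ← Matrix.SpecialLinearGroup.coe_mul (φ s), mul_inv_cancel, Matrix.SpecialLinearGroup.coe_one]
  simp only [e]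
  exact isBigO_matrix_mul (p := 2) (q := 0) (fun i j => by simpa using hc i j)
    (fun i j => by
      simpa using Asymptotics.isBigO_const_const (((φ s)⁻¹ : G m n).1 i j) (one_ne_zero (α := ℝ)) _)
    i j

theorem increment_sub_one_isBigO {φ : ℝ → G m n} {s : ℝ}
    {A : Matrix (Fin m ⊕ Fin n) (Fin m ⊕ Fin n) ℝ}
    (hA : ∀ i j, (fun ξ => (increment φ s ξ - 1 - ξ • A) i j) =O[𝓝[offsets s] 0] fun ξ => ξ ^ 2)
    (i j) : (fun ξ => (increment φ s ξ - 1) i j) =O[𝓝[offsets s] 0] fun ξ => ξ := by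
  have h1 : (fun ξ : ℝ => ξ ^ 2) =O[𝓝[offsets s] 0] fun ξ => ξ := by
    have := (Asymptotics.isLittleO_pow_id (𝕜 := ℝ) one_lt_two).isBigO
    exact this.mono nhdsWithin_le_nhds
  have h2 : (fun ξ : ℝ => ξ * A i j) =O[𝓝[offsets s] 0] fun ξ => ξ := by
    simpa [mul_comm] using (Asymptotics.isBigO_refl (fun ξ : ℝ => ξ) _).const_mul_left (A i j)
  refine (((hA i j).trans h1).add h2).congr_left fun ξ => ?_
  simp

theorem tendsto_increment {φ : ℝ → G m n} (hφ : IsAnalyticCurve φ) {s : ℝ}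
    (hs : s ∈ Icc (0 : ℝ) 1) (i j) : Tendsto (fun ξ => increment φ s ξ i j) (𝓝[offsets s] 0)
      (𝓝 ((1 : Matrix (Fin m ⊕ Fin n) (Fin m ⊕ Fin n) ℝ) i j)) := by
  obtain ⟨A, hA⟩ := exists_increment_expansion hφ hs
  have h := (increment_sub_one_isBigO hA i j).trans_tendsto
    (tendsto_id.mono_left nhdsWithin_le_nhds)
  simpa using h.add_const ((1 : Matrix (Fin m ⊕ Fin n) (Fin m ⊕ Fin n) ℝ) i j)

theorem exp_gPlus (Y : Matrix (Fin m) (Fin n) ℝ) :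
    NormedSpace.exp (gPlus Y) = Matrix.fromBlocks 1 Y 0 1 := by
  simpa using exp_smul_gPlus Y 1

/-- The tangent direction is the derivative of the upper right block. -/
theorem IsHorosphericalTangent.tendsto {φ : ℝ → G m n} (hφ : IsAnalyticCurve φ) {s : ℝ}
    (hs : s ∈ Icc (0 : ℝ) 1) {Y : Matrix (Fin m) (Fin n) ℝ} (hY : IsHorosphericalTangent φ s Y)
    (i : Fin m) (j : Fin n) :
    Tendsto (fun ξ => ξ⁻¹ * increment φ s ξ (Sum.inl i) (Sum.inr j)) (𝓝[offsets s \ {0}] 0)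
      (𝓝 (Y i j)) := by
  obtain ⟨Φm, Φp, h1, _, h3⟩ := hY
  have hle : 𝓝[offsets s \ {0}] (0 : ℝ) ≤ 𝓝[offsets s] 0 := nhdsWithin_mono _ sdiff_subset
  have hne : ∀ᶠ ξ : ℝ in 𝓝[offsets s \ {0}] 0, ξ ≠ 0 :=
    eventually_mem_nhdsWithin.mono fun ξ h => h.2
  have hΦ : ∀ k, Tendsto (fun ξ => ξ⁻¹ * Φp ξ k j) (𝓝[offsets s \ {0}] 0) (𝓝 (Y k j)) := by
    intro k
    have a1 : (fun ξ => ξ⁻¹ * (Φp ξ k j - ξ * Y k j)) =O[𝓝[offsets s \ {0}] 0]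
        fun ξ => ξ⁻¹ * ξ ^ 2 := (Asymptotics.isBigO_refl _ _).mul ((h3 k j).mono hle)
    have a2 : Tendsto (fun ξ : ℝ => ξ⁻¹ * ξ ^ 2) (𝓝[offsets s \ {0}] 0) (𝓝 0) := by
      refine (tendsto_id.mono_left nhdsWithin_le_nhds).congr' ?_
      filter_upwards [hne] with ξ hξ
      simp only [id]
      field_simp
    have a3 := (a1.trans_tendsto a2).add_const (Y k j)
    rw [zero_add] at a3
    refine a3.congr' ?_
    filter_upwards [hne] with ξ hξ
    field_simp
    ring
  have hsum : Tendsto (fun ξ => ∑ k, increment φ s ξ (Sum.inl i) (Sum.inl k) * (ξ⁻¹ * Φp ξ k j))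
      (𝓝[offsets s \ {0}] 0) (𝓝 (∑ k, (1 : Matrix (Fin m ⊕ Fin n) (Fin m ⊕ Fin n) ℝ)
        (Sum.inl i) (Sum.inl k) * Y k j)) :=
    tendsto_finsetSum _ fun k _ => ((tendsto_increment hφ hs _ _).mono_left hle).mul (hΦ k)
  have e : ∑ k, (1 : Matrix (Fin m ⊕ Fin n) (Fin m ⊕ Fin n) ℝ) (Sum.inl i) (Sum.inl k) * Y k j =
      Y i j := by simp [Matrix.one_apply]
  rw [e] at hsum
  refine hsum.congr' ?_
  filter_upwards [hle h1] with ξ hξ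
  obtain ⟨hP, hN⟩ := hξ
  -- With E = exp(Φ⁰⁻) block lower triangular and exp(Φ⁺) block unipotent, the increment N satisfies
  -- N₁₂ = N₁₁ Φ⁺. As N₁₁ tends to 1, ξ⁻¹ N₁₂ and ξ⁻¹ Φ⁺ have the same limit Y.
  have hE := toBlocks₁₂_exp hP.2
  set E := NormedSpace.exp (Φm ξ) with hEdef
  change increment φ s ξ = E * _ at hN
  have hE0 : ∀ k, E (Sum.inl i) (Sum.inr k) = 0 := fun k => congrFun (congrFun hE i) k
  rw [exp_gPlus] at hN
  have n1 : ∀ k, increment φ s ξ (Sum.inl i) (Sum.inl k) = E (Sum.inl i) (Sum.inl k) := fun k => by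
    rw [hN, Matrix.mul_apply, Fintype.sum_sum_type]
    simp [Matrix.one_apply]
  have n2 : increment φ s ξ (Sum.inl i) (Sum.inr j) = ∑ k, E (Sum.inl i) (Sum.inl k) * Φp ξ k j := by
    rw [hN, Matrix.mul_apply, Fintype.sum_sum_type]
    simp [hE0]
  rw [n2, Finset.mul_sum]
  refine Finset.sum_congr rfl fun k _ => ?_
  rw [n1]
  ring

/-- Near ξ = 0 the upper left block Q of the increment N is invertible, and N₁₂ = Q Φ⁺ forces Φ⁺ =
Q⁻¹ N₁₂. Then P = N exp(-Φ⁺) is block lower triangular and 1 + O(ξ), and Φ⁰⁻ is its logarithm. Y is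
the upper right block of the derivative of N. -/
theorem exists_isHorosphericalTangent {φ : ℝ → G m n} (hφ : IsAnalyticCurve φ) {s : ℝ}
    (hs : s ∈ Icc (0 : ℝ) 1) : ∃ Y : Matrix (Fin m) (Fin n) ℝ, IsHorosphericalTangent φ s Y := by
  obtain ⟨A, hA⟩ := exists_increment_expansion hφ hs
  have hN1 := increment_sub_one_isBigO hA
  have hNlim := tendsto_increment hφ hs
  set l := 𝓝[offsets s] (0 : ℝ) with hl
  have hl0 : l ≤ 𝓝 0 := nhdsWithin_le_nhds
  set N := increment φ s with hN
  set Y := A.toBlocks₁₂ with hY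
  let Q : ℝ → Matrix (Fin m) (Fin m) ℝ := fun ξ => (N ξ).toBlocks₁₁
  have hQlim : Tendsto Q l (𝓝 1) := by
    refine tendsto_pi_nhds.2 fun i => tendsto_pi_nhds.2 fun j => ?_
    have := hNlim (Sum.inl i) (Sum.inl j)
    simpa [Matrix.one_apply, Q, Matrix.toBlocks₁₁] using this
  have hdet : Tendsto (fun ξ => (Q ξ).det) l (𝓝 1) := by
    have := ((Continuous.matrix_det continuous_id).tendsto (1 : Matrix (Fin m) (Fin m) ℝ)).comp
      hQlim
    simpa [Function.comp_def] using this
  have hunit : ∀ᶠ ξ in l, IsUnit (Q ξ).det :=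
    (hdet.eventually_ne one_ne_zero).mono fun ξ h => h.isUnit
  have hinv : Tendsto (fun ξ => (Q ξ)⁻¹) l (𝓝 1) := by
    have h1 : Tendsto (fun ξ => ((Q ξ).det)⁻¹ • (Q ξ).adjugate) l
        (𝓝 ((1 : ℝ)⁻¹ • (1 : Matrix (Fin m) (Fin m) ℝ).adjugate)) :=
      (hdet.inv₀ one_ne_zero).smul (((Continuous.matrix_adjugate continuous_id).tendsto _).comp
        hQlim)
    simpa [Matrix.inv_def, Ring.inverse_eq_inv'] using h1
  have hinvO : ∀ i j, (fun ξ => (Q ξ)⁻¹ i j) =O[l] fun ξ => ξ ^ 0 := fun i j => by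
    simpa using (tendsto_pi_nhds.1 (tendsto_pi_nhds.1 hinv i) j).isBigO_one ℝ
  let Φp : ℝ → Matrix (Fin m) (Fin n) ℝ := fun ξ => (Q ξ)⁻¹ * (N ξ).toBlocks₁₂
  have hpO : ∀ i j, (fun ξ => Φp ξ i j) =O[l] fun ξ => ξ := fun i j => by
    have := isBigO_matrix_mul (p := 0) (q := 1) hinvO (V := fun ξ => (N ξ).toBlocks₁₂)
      (fun i j => by simpa [Matrix.toBlocks₁₂] using hN1 (Sum.inl i) (Sum.inr j)) i j
    simpa using this
  have hpY : ∀ i j, (fun ξ => Φp ξ i j - ξ * Y i j) =O[l] fun ξ => ξ ^ 2 := fun i j => by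
    have b1 : ∀ i j, (fun ξ => ((N ξ).toBlocks₁₂ - ξ • Y) i j) =O[l] fun ξ => ξ ^ 2 :=
      fun i j => by simpa [Y, Matrix.toBlocks₁₂] using hA (Sum.inl i) (Sum.inr j)
    have b2 : ∀ i j, (fun ξ => ((Q ξ - 1) * (ξ • Y) : Matrix (Fin m) (Fin n) ℝ) i j) =O[l] fun ξ => ξ ^ 2 := by
      refine isBigO_matrix_mul (p := 1) (q := 1) (fun i j => ?_) (fun i j => ?_)
      · simpa [Matrix.one_apply, Q, Matrix.toBlocks₁₁] using hN1 (Sum.inl i) (Sum.inl j)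
      · simpa [mul_comm] using (Asymptotics.isBigO_refl (fun ξ : ℝ => ξ) l).const_mul_left (Y i j)
    -- Φ⁺ - ξY = Q⁻¹ (N₁₂ - ξY - (Q - 1) ξY), and (Q - 1) ξY is a product of two first order terms.
    have b3 := isBigO_matrix_mul (p := 0) (q := 2) hinvO
      (V := fun ξ => ((N ξ).toBlocks₁₂ - ξ • Y) - (Q ξ - 1) * (ξ • Y))
      (fun i j => by simpa using (b1 i j).sub (b2 i j)) i j
    rw [zero_add] at b3
    refine b3.congr' ?_ EventuallyEq.rfl
    filter_upwards [hunit] with ξ hξ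
    have : (Q ξ)⁻¹ * ((N ξ).toBlocks₁₂ - ξ • Y - (Q ξ - 1) * (ξ • Y)) = Φp ξ - ξ • Y := by
      rw [Matrix.sub_mul, Matrix.one_mul, sub_sub_sub_cancel_right, Matrix.mul_sub,
        ← Matrix.mul_assoc, Matrix.nonsing_inv_mul _ hξ, Matrix.one_mul]
    rw [this]
    simp
  let P : ℝ → Matrix (Fin m ⊕ Fin n) (Fin m ⊕ Fin n) ℝ := fun ξ =>
    N ξ * Matrix.fromBlocks 1 (-Φp ξ) 0 1
  have hP12 : ∀ᶠ ξ in l, (P ξ).toBlocks₁₂ = 0 := by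
    filter_upwards [hunit] with ξ hξ
    have e : P ξ = Matrix.fromBlocks (Q ξ) ((N ξ).toBlocks₁₂) ((N ξ).toBlocks₂₁)
        ((N ξ).toBlocks₂₂) * Matrix.fromBlocks 1 (-Φp ξ) 0 1 := by
      simp only [P, Q, Matrix.fromBlocks_toBlocks]
    rw [e, Matrix.fromBlocks_multiply, Matrix.toBlocks_fromBlocks₁₂]
    simp only [Φp, Matrix.mul_neg, Matrix.mul_one]
    rw [← Matrix.mul_assoc, Matrix.mul_nonsing_inv _ hξ, Matrix.one_mul, neg_add_cancel]
  have hP1 : ∀ i j, (fun ξ => (P ξ - 1) i j) =O[l] fun ξ => ξ := by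
    have u0 : ∀ i j, (fun ξ => (Matrix.fromBlocks 0 (-Φp ξ) 0 0 :
        Matrix (Fin m ⊕ Fin n) (Fin m ⊕ Fin n) ℝ) i j) =O[l] fun ξ => ξ := by
      rintro (i | i) (j | j)
      · simpa using Asymptotics.isBigO_zero _ _
      · simpa using hpO i j
      · simpa using Asymptotics.isBigO_zero _ _
      · simpa using Asymptotics.isBigO_zero _ _
    have n0 : ∀ i j, (fun ξ => N ξ i j) =O[l] fun ξ => ξ ^ 0 := fun i j => by
      simpa using (hNlim i j).isBigO_one ℝ
    have h1 := isBigO_matrix_mul (p := 0) (q := 1) n0 (fun i j => by simpa using u0 i j)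
    intro i j
    simp only [zero_add, pow_one] at h1
    refine ((h1 i j).add (hN1 i j)).congr_left fun ξ => ?_
    have : (Matrix.fromBlocks 1 (-Φp ξ) 0 1 : Matrix (Fin m ⊕ Fin n) (Fin m ⊕ Fin n) ℝ) =
        Matrix.fromBlocks 0 (-Φp ξ) 0 0 + 1 := by
      rw [← Matrix.fromBlocks_one, Matrix.fromBlocks_add]
      simp
    simp only [P, this, mul_add, mul_one, add_sub_assoc, Matrix.add_apply]
  obtain ⟨Φm, hexp, hm12, hmO⟩ := exists_block_log hl0 hP12 hP1
  refine ⟨Y, Φm, Φp, ?_, hmO, hpY⟩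
  filter_upwards [hexp] with ξ hξ
  refine ⟨⟨?_, hm12 ξ⟩, ?_⟩
  -- Tracelessness of Φ⁰⁻ follows from e^{tr Φ⁰⁻} = det P = 1.
  · have h1 := det_exp (Φm ξ)
    have h2 : (P ξ).det = 1 := by
      simp only [P, Matrix.det_mul, Matrix.det_fromBlocks_zero₂₁, Matrix.det_one, mul_one, hN]
      exact (φ (s + ξ) * (φ s)⁻¹).2
    rw [hξ, h2] at h1
    exact Real.exp_eq_one_iff _ |>.1 h1.symm
  · rw [hξ, exp_gPlus]
    change N ξ = N ξ * _ * _
    rw [mul_assoc, Matrix.fromBlocks_multiply]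
    simp

theorem existsUnique_isHorosphericalTangent {φ : ℝ → G m n} (hφ : IsAnalyticCurve φ) {s : ℝ}
    (hs : s ∈ Icc (0 : ℝ) 1) : ∃! Y : Matrix (Fin m) (Fin n) ℝ, IsHorosphericalTangent φ s Y := by
  obtain ⟨Y, hY⟩ := exists_isHorosphericalTangent hφ hs
  refine ⟨Y, hY, fun Y' hY' => ?_⟩
  have := neBot_nhdsWithin_offsets hs
  ext i j
  exact tendsto_nhds_unique (hY'.tendsto hφ hs i j) (hY.tendsto hφ hs i j)

/-! ### Extending the curve to ℝ, so that shifted parameters may leave [0,1]. -/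

section CurveExtension

variable {m n : ℕ}

/-- The extension of a curve on `[0,1]` which is constant on both sides. -/
noncomputable def extend (φ : ℝ → G m n) (s : ℝ) : G m n := φ (projIcc (0 : ℝ) 1 zero_le_one s)

theorem extend_of_mem (φ : ℝ → G m n) {s : ℝ} (hs : s ∈ Icc (0 : ℝ) 1) : extend φ s = φ s := by
  rw [extend, projIcc_of_mem zero_le_one hs]

/-- The entries are C¹ on a compact interval, hence Lipschitz there, and the projection onto [0,1]
is 1-Lipschitz. -/
theorem exists_lipschitz_extend {φ : ℝ → G m n} (hφ : IsAnalyticCurve φ) :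
    ∃ K, ∀ s s', entrySum ((extend φ s).1 - (extend φ s').1) ≤ K * |s - s'| := by
  have h : ∀ i j, ∃ K : NNReal, LipschitzOnWith K (fun s => (φ s).1 i j) (Icc 0 1) := fun i j =>
    (hφ i j).contDiffOn (n := 1) (uniqueDiffOn_Icc zero_lt_one)
      |>.exists_lipschitzOnWith one_ne_zero (convex_Icc 0 1) isCompact_Icc
  choose K hK using h
  refine ⟨∑ i, ∑ j, (K i j : ℝ), fun s s' => ?_⟩
  have hp : |((projIcc (0 : ℝ) 1 zero_le_one s : ℝ)) - projIcc (0 : ℝ) 1 zero_le_one s'| ≤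
      |s - s'| := by
    simpa [Subtype.dist_eq, Real.dist_eq] using
      (LipschitzWith.projIcc (zero_le_one (α := ℝ))).dist_le_mul s s'
  rw [entrySum, Finset.sum_mul]
  refine Finset.sum_le_sum fun i _ => ?_
  rw [Finset.sum_mul]
  refine Finset.sum_le_sum fun j _ => ?_
  have := (hK i j).dist_le_mul _ (projIcc (0 : ℝ) 1 zero_le_one s).2 _
    (projIcc (0 : ℝ) 1 zero_le_one s').2
  exact this.trans (mul_le_mul_of_nonneg_left hp (K i j).2)

theorem continuous_extend {φ : ℝ → G m n} (hφ : IsAnalyticCurve φ) : Continuous (extend φ) := by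
  have h : ∀ i j, Continuous fun s => (extend φ s).1 i j := fun i j =>
    (continuousOn_iff_continuous_domRestrict.1 (hφ i j).continuousOn).comp continuous_projIcc
  exact continuous_induced_rng.2 (continuous_pi fun i => continuous_pi fun j => h i j)

theorem exists_bound_extend_inv {φ : ℝ → G m n} (hφ : IsAnalyticCurve φ) :
    ∃ B, ∀ s, entrySum ((extend φ s)⁻¹ : G m n).1 ≤ B := by
  have hc : Continuous fun s => entrySum ((extend φ s)⁻¹ : G m n).1 :=
    continuous_entrySum.comp (continuous_subtype_val.comp (continuous_extend hφ).inv)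
  obtain ⟨B, hB⟩ := (isCompact_Icc (a := (0 : ℝ)) (b := 1)).exists_bound_of_continuousOn
    hc.continuousOn
  refine ⟨B, fun s => ?_⟩
  have h := (le_abs_self _).trans (hB _ (projIcc (0 : ℝ) 1 zero_le_one s).2)
  rwa [extend_of_mem φ (projIcc (0 : ℝ) 1 zero_le_one s).2] at h

end CurveExtension

/-! ### From shifts along the curve to the unipotent flow. -/

section Unipotent

variable {m n : ℕ}

theorem coe_unipotentFlow (Y : Matrix (Fin m) (Fin n) ℝ) (x : ℝ) :
    (unipotentFlow Y x).1 = Matrix.fromBlocks 1 (x • Y) 0 1 := exp_smul_gPlus Y x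

theorem unipotentFlow_zero (Y : Matrix (Fin m) (Fin n) ℝ) : unipotentFlow Y 0 = 1 := by
  apply Subtype.ext
  rw [coe_unipotentFlow, zero_smul, Matrix.fromBlocks_one, Matrix.SpecialLinearGroup.coe_one]

theorem unipotentFlow_add (Y : Matrix (Fin m) (Fin n) ℝ) (x x' : ℝ) :
    unipotentFlow Y (x + x') = unipotentFlow Y x * unipotentFlow Y x' := by
  apply Subtype.ext
  rw [Matrix.SpecialLinearGroup.coe_mul, coe_unipotentFlow, coe_unipotentFlow, coe_unipotentFlow,
    Matrix.fromBlocks_multiply]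
  simp [add_smul, add_comm]

theorem continuous_unipotentFlow (Y : Matrix (Fin m) (Fin n) ℝ) :
    Continuous (unipotentFlow Y) := by
  have h : Continuous fun x : ℝ => (Matrix.fromBlocks 1 (x • Y) 0 1 :
      Matrix (Fin m ⊕ Fin n) (Fin m ⊕ Fin n) ℝ) :=
    Continuous.matrix_fromBlocks continuous_const (by fun_prop) continuous_const continuous_const
  exact continuous_induced_rng.2 (h.congr fun x => (coe_unipotentFlow Y x).symm)

variable [NeZero m] [NeZero n]

/-- Conjugation by the diagonal flow turns the curve into its horospherical tangent. -/
theorem tendsto_conj_increment {φ : ℝ → G m n} (hφ : IsAnalyticCurve φ) {s : ℝ}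
    (hs : s ∈ Ioo (0 : ℝ) 1) {Y : Matrix (Fin m) (Fin n) ℝ} (hY : IsHorosphericalTangent φ s Y)
    (x : ℝ) :
    Tendsto (fun t => a m n t * (φ (s + x * Real.exp (-rate m n * t)) * (φ s)⁻¹) * (a m n t)⁻¹)
      atTop (𝓝 (unipotentFlow Y x)) := by
  rcases eq_or_ne x 0 with rfl | hx
  · rw [unipotentFlow_zero]
    simp
  have hexp : Tendsto (fun t => Real.exp (-rate m n * t)) atTop (𝓝 0) :=
    Real.tendsto_exp_atBot.comp
      (tendsto_id.const_mul_atTop_of_neg (neg_lt_zero.2 (rate_pos m n)))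
  have hξ0 : Tendsto (fun t => x * Real.exp (-rate m n * t)) atTop (𝓝 0) := by
    simpa using hexp.const_mul x
  have hξ : Tendsto (fun t => x * Real.exp (-rate m n * t)) atTop (𝓝[offsets s \ {0}] 0) := by
    refine tendsto_nhdsWithin_iff.2 ⟨hξ0, ?_⟩
    have h1 : Ioo (-s) (1 - s) ∈ 𝓝 (0 : ℝ) := Ioo_mem_nhds (by linarith [hs.1]) (by linarith [hs.2])
    filter_upwards [hξ0.eventually h1] with t ht
    exact ⟨⟨by linarith [ht.1], by linarith [ht.2]⟩, mul_ne_zero hx (Real.exp_ne_zero _)⟩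
  have hξ' := hξ.mono_right (nhdsWithin_mono (0 : ℝ) (sdiff_subset (s := offsets s) (t := {0})))
  have hs' : s ∈ Icc (0 : ℝ) 1 := Ioo_subset_Icc_self hs
  have hN := fun i j => (tendsto_increment hφ hs' i j).comp hξ'
  have e : ∀ t i j, (a m n t * (φ (s + x * Real.exp (-rate m n * t)) * (φ s)⁻¹) *
      (a m n t)⁻¹ : G m n).1 i j = Real.exp ((weight m n i - weight m n j) * t) *
        increment φ s (x * Real.exp (-rate m n * t)) i j := fun t i j => conj_apply t _ i j
  refine tendsto_subtype_rng.2 (tendsto_pi_nhds.2 fun i => tendsto_pi_nhds.2 fun j => ?_)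
  rw [coe_unipotentFlow]
  refine Tendsto.congr (fun t => (e t i j).symm) ?_
  rcases i with i | i <;> rcases j with j | j
  · simpa [weight, Matrix.one_apply, Function.comp_def] using hN (Sum.inl i) (Sum.inl j)
  -- With ξ = x e^{-rate · t}, the expansion factor e^{rate · t} is exactly x ξ⁻¹, so this block
  -- tends to x Y.
  · have h1 := ((hY.tendsto hφ hs' i j).comp hξ).const_mul x
    simp only [Matrix.fromBlocks_apply₁₂, Matrix.smul_apply, smul_eq_mul]
    refine h1.congr fun t => ?_
    have hw : weight m n (Sum.inl i) - weight m n (Sum.inr j) = rate m n := by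
      simp [weight, rate]
    simp only [Function.comp_apply, hw, mul_inv, ← Real.exp_neg, neg_mul, neg_neg]
    field_simp
  · have h1 := hexp.mul (hN (Sum.inr i) (Sum.inl j))
    have hw : weight m n (Sum.inr i) - weight m n (Sum.inl j) = -rate m n := by
      simp only [weight, rate, Sum.elim_inl, Sum.elim_inr]
      ring
    simpa [hw] using h1
  · simpa [weight, Matrix.one_apply, Function.comp_def] using hN (Sum.inr i) (Sum.inr j)

theorem continuous_trajectory (y : X m n) : Continuous fun t => a m n t • y :=
  (continuous_a (m := m) (n := n)).smul (continuous_const (y := y))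

/-- For almost every `s`, test functions and their translates by the unipotent flow in the tangent
direction have the same averages along the trajectory of `φ(s) Λ`. -/
theorem ae_tendsto_average_unipotent {φ : ℝ → G m n} (hφ : IsAnalyticCurve φ) (Λ : X m n) :
    ∀ᵐ s ∂(volume.restrict (Icc (0 : ℝ) 1)), ∀ Y, IsHorosphericalTangent φ s Y →
      ∀ (f : C_c(X m n, ℝ)) (x : ℝ), Tendsto (fun T : ℝ => T⁻¹ * ∫ t in (0 : ℝ)..T,
        (f (a m n t • φ s • Λ) - f (unipotentFlow Y x • a m n t • φ s • Λ))) atTop (𝓝 0) := by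
  obtain ⟨K, hK⟩ := exists_lipschitz_extend hφ
  obtain ⟨B, hB⟩ := exists_bound_extend_inv hφ
  have hψ := continuous_extend hφ
  obtain ⟨S, hSc, hS⟩ := exists_countable_dense_compactlySupported (X m n)
  have hIoo : ∀ᵐ s ∂(volume.restrict (Icc (0 : ℝ) 1)), s ∈ Ioo (0 : ℝ) 1 := by
    rw [← restrict_Ioo_eq_restrict_Icc]
    exact ae_restrict_mem measurableSet_Ioo
  -- The exceptional null set depends on the test function and on x, so both are restricted to
  -- countable sets here.
  have hae : ∀ᵐ s ∂(volume.restrict (Icc (0 : ℝ) 1)), ∀ f ∈ S, ∀ x : ℚ, Tendsto (fun T : ℝ =>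
      T⁻¹ * ∫ t in (0 : ℝ)..T, (f (a m n t • extend φ s • Λ) -
        f (a m n t • extend φ (s + x * Real.exp (-rate m n * t)) • Λ))) atTop (𝓝 0) :=
    (ae_ball_iff hSc).2 fun f _ => ae_all_iff.2 fun x =>
      ae_tendsto_average_orbit hψ hK hB Λ f x
  filter_upwards [hIoo, hae] with s hs hlim Y hY f x
  have hs' : s ∈ Icc (0 : ℝ) 1 := Ioo_subset_Icc_self hs
  have horb : Continuous fun t => a m n t • φ s • Λ := continuous_trajectory _
  have hcurve : ∀ x' : ℝ,
      Continuous fun t => a m n t • extend φ (s + x' * Real.exp (-rate m n * t)) • Λ := fun x' =>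
    (continuous_a (m := m) (n := n)).smul ((hψ.comp (by fun_prop)).smul continuous_const)
  refine tendsto_average_of_approx ((f.continuous.comp horb).sub
    
    (f.continuous.comp ((continuous_const_smul (unipotentFlow Y x)).comp horb))) fun ε hε => ?_
  -- The four errors of ε/4 are: f against f' at two points, x against the rational q, and exp(qY)
  -- against the conjugated increment of the curve.
  obtain ⟨f', hf', hff'⟩ := hS f (ε / 4) (by positivity)
  have huc := eventually_forall_abs_smul_sub_lt (H := G m n) f' (show 0 < ε / 4 by positivity)
  have hx : ∀ᶠ r in 𝓝 x, ∀ y, |f' (unipotentFlow Y (x - r) • y) - f' y| < ε / 4 := by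
    have h1 : Tendsto (fun r => unipotentFlow Y (x - r)) (𝓝 x) (𝓝 1) := by
      have := ((continuous_unipotentFlow Y).comp (continuous_const.sub continuous_id)).tendsto x
        (f := fun r : ℝ => unipotentFlow Y (x - r))
      simpa [unipotentFlow_zero] using this
    exact h1.eventually huc
  obtain ⟨_, ⟨q, rfl⟩, hq⟩ := (Rat.denseRange_cast (𝕜 := ℝ)).inter_nhds_nonempty hx
  have hpt : ∀ᶠ t in atTop, ∀ y, |f' ((a m n t * (φ (s + q * Real.exp (-rate m n * t)) * (φ s)⁻¹) *
      (a m n t)⁻¹ * (unipotentFlow Y q)⁻¹) • y) - f' y| < ε / 4 := by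
    have h1 := (tendsto_conj_increment hφ hs hY q).mul_const (unipotentFlow Y q)⁻¹
    rw [mul_inv_cancel] at h1
    exact h1.eventually huc
  have hmem : ∀ᶠ t in atTop, s + q * Real.exp (-rate m n * t) ∈ Icc (0 : ℝ) 1 := by
    have hexp : Tendsto (fun t => Real.exp (-rate m n * t)) atTop (𝓝 0) :=
      Real.tendsto_exp_atBot.comp
        (tendsto_id.const_mul_atTop_of_neg (neg_lt_zero.2 (rate_pos m n)))
    have h1 : Tendsto (fun t => s + q * Real.exp (-rate m n * t)) atTop (𝓝 s) := by
      simpa using (hexp.const_mul (q : ℝ)).const_add s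
    exact h1.eventually (Icc_mem_nhds hs.1 hs.2)
  have horb' : Continuous fun t => a m n t • extend φ s • Λ := continuous_trajectory _
  refine ⟨fun t => f' (a m n t • extend φ s • Λ) -
    f' (a m n t • extend φ (s + q * Real.exp (-rate m n * t)) • Λ),
    (f'.continuous.comp horb').sub (f'.continuous.comp (hcurve q)), ?_, hlim f' hf' q⟩
  filter_upwards [hpt, hmem] with t ht htm
  have b1 := abs_lt.1 (hff' (a m n t • φ s • Λ))
  have b2 := abs_lt.1 (hff' (unipotentFlow Y x • a m n t • φ s • Λ))
  have b3 := abs_lt.1 (hq (unipotentFlow Y q • a m n t • φ s • Λ))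
  have b4 := abs_lt.1 (ht (unipotentFlow Y q • a m n t • φ s • Λ))
  rw [smul_smul, ← unipotentFlow_add, sub_add_cancel] at b3
  rw [show (a m n t * (φ (s + q * Real.exp (-rate m n * t)) * (φ s)⁻¹) *
    (a m n t)⁻¹ * (unipotentFlow Y q)⁻¹) • unipotentFlow Y q • a m n t • φ s • Λ =
    a m n t • φ (s + q * Real.exp (-rate m n * t)) • Λ by
      simp only [smul_smul]; congr 1; group] at b4
  rw [extend_of_mem φ hs', extend_of_mem φ htm, abs_le]
  constructor <;> linarith

end Unipotent

/-! ### Passage to weak* limits. -/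

section Limits

variable {m n : ℕ}

theorem integral_timeAverage [NeZero m] [NeZero n] (φ : ℝ → G m n) (Λ : X m n) (s : ℝ) {T : ℝ}
    (hT : 0 < T) (f : C_c(X m n, ℝ)) :
    ∫ y, f y ∂(timeAverage φ Λ s T) = T⁻¹ * ∫ t in (0 : ℝ)..T, f (a m n t • φ s • Λ) := by
  have horb : Continuous fun t => a m n t • φ s • Λ := continuous_trajectory _
  have hmap : ∫ y, f y ∂((volume.restrict (Icc 0 T)).map fun t => a m n t • φ s • Λ) =
      ∫ t in Icc 0 T, f (a m n t • φ s • Λ) :=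
    integral_map horb.measurable.aemeasurable f.continuous.aestronglyMeasurable
  rw [timeAverage, integral_smul_measure, hmap, ENNReal.toReal_inv, ENNReal.toReal_ofReal hT.le, integral_Icc_eq_integral_Ioc,
    ← intervalIntegral.integral_of_le hT.le, smul_eq_mul]

/-- Locally finite measures with the same integrals of translates are invariant. -/
theorem measurePreserving_smul_of_integral {μ : Measure (X m n)} [IsFiniteMeasureOnCompacts μ]
    (g : G m n) (h : ∀ f : C_c(X m n, ℝ), ∫ y, f (g • y) ∂μ = ∫ y, f y ∂μ) :
    MeasurePreserving (fun y : X m n => g • y) μ μ := by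
  have hg : Measurable fun y : X m n => g • y := (continuous_const_smul g).measurable
  refine ⟨hg, ?_⟩
  have : IsFiniteMeasureOnCompacts (μ.map fun y : X m n => g • y) :=
    Measure.IsFiniteMeasureOnCompacts.map μ (Homeomorph.smul g)
  refine Measure.ext_of_integral_eq_on_compactlySupported fun f => ?_
  exact (integral_map hg.aemeasurable f.continuous.aestronglyMeasurable).trans (h f)

end Limits

end HorosphereCurve

theorem theorem6p2 (m n : ℕ) [NeZero m] [NeZero n]
    (φ : ℝ → HorosphereCurve.G m n) (hφ : HorosphereCurve.IsAnalyticCurve φ)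
    (Λ : HorosphereCurve.X m n) :
    (∀ s ∈ Set.Icc (0 : ℝ) 1, ∃! Y : Matrix (Fin m) (Fin n) ℝ,
      HorosphereCurve.IsHorosphericalTangent φ s Y) ∧
    ∀ᵐ s ∂(MeasureTheory.volume.restrict (Set.Icc (0 : ℝ) 1)),
      ∀ Y : Matrix (Fin m) (Fin n) ℝ, HorosphereCurve.IsHorosphericalTangent φ s Y →
        ∀ μ : MeasureTheory.Measure (HorosphereCurve.X m n),
          MeasureTheory.IsFiniteMeasureOnCompacts μ →
          HorosphereCurve.IsWeakStarLimit (HorosphereCurve.timeAverage φ Λ s) μ →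
          ∀ x : ℝ, MeasureTheory.MeasurePreserving
            (fun y : HorosphereCurve.X m n => HorosphereCurve.unipotentFlow Y x • y) μ μ := by
  refine ⟨fun s hs => HorosphereCurve.existsUnique_isHorosphericalTangent hφ hs, ?_⟩
  filter_upwards [HorosphereCurve.ae_tendsto_average_unipotent hφ Λ] with s hs Y hY μ hμ hlim x
  obtain ⟨T, hT, hw⟩ := hlim
  refine HorosphereCurve.measurePreserving_smul_of_integral _ fun f => ?_
  set u := HorosphereCurve.unipotentFlow Y x
  let fu : C_c(HorosphereCurve.X m n, ℝ) :=
    ⟨⟨fun y => f (u • y), f.continuous.comp (continuous_const_smul u)⟩,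
      f.hasCompactSupport.comp_homeomorph (Homeomorph.smul u)⟩
  have horb : Continuous fun t => HorosphereCurve.a m n t • φ s • Λ :=
    HorosphereCurve.continuous_trajectory _
  have h0 := (hs Y hY f x).comp hT
  have h1 := (hw f).sub (hw fu)
  have h2 := tendsto_nhds_unique (h1.congr' ?_) h0
  · exact (sub_eq_zero.1 h2).symm
  -- The integral formula for `timeAverage` needs T_k > 0, which holds only for large k.
  filter_upwards [hT.eventually_gt_atTop 0] with k hk
  rw [HorosphereCurve.integral_timeAverage φ Λ s hk, HorosphereCurve.integral_timeAverage φ Λ s hk,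
    ← mul_sub]
  exact congrArg _ (intervalIntegral.integral_sub
    ((f.continuous.comp horb).intervalIntegrable _ _)
    ((fu.continuous.comp horb).intervalIntegrable _ _)).symm
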